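/- Call the simplicial complex with vertex set $\mathbb Z/8$ and the sixteen triangles $\{a,a+1,a+3\}$, $\{a,a+2,a+3\}$ ($a\in\mathbb Z/8$) the uniform triangulation; it is a torus in which every vertex has degree $6$. Put $\rho(u,v,w)=(-u,-v,w)$ on $\mathbb R^3$. A pup tent is a choice of points $P_j\in\mathbb R^3$ ($j\in\mathbb Z/8$) such that (i) the polyhedral torus that they span on the uniform triangulation is embedded in $\mathbb R^3$, with non-degenerate triangles, and is a paper torus, that is, its cone angle at each vertex is $2\pi$; (ii) $P_{7-j}=\rho(P_j)$ for all $j$; (iii) of the sixteen triangles, exactly the six triangles $\{1,2,4\},\{2,4,5\},\{2,3,5\},\{3,5,6\},\{0,5,6\},\{1,2,7\}$ lie in the boundary of the convex hull of the $P_j$. It is in general position if no four of its vertices are coplanar. Let $\mathcal X$ be the space of pup tents modulo similarities of $\mathbb R^3$ (respecting the labels of the vertices), with the quotient topology. Let $\mathcal M=\mathbb H^2/SL_2(\mathbb Z)$ be the modular surface, and let $\Phi:\mathcal X\to\mathcal M$ send a pup tent to the point $[\omega_2/\omega_1]$ for which its intrinsic metric is that of the flat torus $\mathbb C/(\mathbb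 Z\omega_1+\mathbb Z\omega_2)$, where $\mathrm{Im}(\omega_2/\omega_1)>0$ and the torus is oriented so that the triangles $(a,a+2,a+3)$ are positively oriented. Let $\mathcal F=\{z\in\mathbb H^2: 0\le \mathrm{Re}\,z\le \tfrac12,\ |z-1|\ge 1\}$ be the bi-cusped fundamental domain, i.e. the geodesic triangle with vertex $\tfrac12+\tfrac{\sqrt3}{2}i$ and cusps $0,\infty$, and let $\mathcal I$ be its interior, regarded as a subset of $\mathcal M$. Theorem (Near Universality). There is a path-connected subset $\mathcal U\subset\mathcal X$, consisting of general position pup tents, such that $\Phi(\mathcal U)=\mathcal I$. (The modulus $\Phi$ is well defined on $\mathcal U$: each member has one and only one modulus.) -/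

import Mathlib

open scoped MatrixGroups

noncomputable section

namespace PupTent

/-! ### The uniform 8-vertex triangulation of the torus

The vertices are the residues mod 8. -/

/-- The triangles of the uniform triangulation: `{a, a+1, a+3}` and `{a, a+2, a+3}` mod 8. -/
def faces : Finset (Finset (ZMod 8)) :=
  Finset.univ.image (fun a : ZMod 8 => {a, a + 1, a + 3}) ∪
    Finset.univ.image (fun a : ZMod 8 => {a, a + 2, a + 3})

/-- The pattern of six triangles that lie in the boundary of the convex hull of a pup tent. -/
def hullFaces : Finset (Finset (ZMod 8)) :=
  {{1, 2, 4}, {2, 4, 5}, {2, 3, 5}, {3, 5, 6}, {0, 5, 6}, {1, 2, 7}}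

/-- The six neighbours of a vertex `j` are `j + link k`, listed in the cyclic order in which they
occur around `j`: consecutive neighbours span, together with `j`, the six triangles at `j`. -/
def link : Fin 6 → ZMod 8 := ![1, 3, 2, -1, -3, -2]

/-! ### Polyhedral tori in space -/

/-- Euclidean three-space. -/
abbrev E3 : Type := EuclideanSpace ℝ (Fin 3)

/-- The vertex positions of an 8-vertex polyhedral torus. -/
abbrev Config : Type := ZMod 8 → E3

/-- The order two rotation `(u, v, w) ↦ (-u, -v, w)`. -/
def rho (p : E3) : E3 := !₂[-p 0, -p 1, p 2]

/-- The triangle (or edge, or vertex) in space spanned by a set of vertices. -/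
def cell (P : Config) (s : Finset (ZMod 8)) : Set E3 := convexHull ℝ (P '' (s : Set (ZMod 8)))

/-- The polyhedral torus is embedded: the triangles are non-degenerate, and two triangles meet only
in the cell spanned by their common vertices. -/
structure IsEmbedded (P : Config) : Prop where
  nondegenerate : ∀ s ∈ faces, AffineIndependent ℝ (fun i : s => P i)
  inter : ∀ s ∈ faces, ∀ t ∈ faces, cell P s ∩ cell P t ⊆ cell P (s ∩ t)

/-- The cone angle at the vertex `j`: the sum of the angles at `j` of the six incident triangles. -/
def coneAngle (P : Config) (j : ZMod 8) : ℝ :=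
  ∑ k : Fin 6, EuclideanGeometry.angle (P (j + link k)) (P j) (P (j + link (k + 1)))

/-- A paper torus on the uniform triangulation: an embedded polyhedral torus
all of whose cone angles are `2π`. -/
structure IsPaperTorus (P : Config) : Prop where
  embedded : IsEmbedded P
  flat : ∀ j, coneAngle P j = 2 * Real.pi

/-- A pup tent: an 8-vertex uniformly triangulated paper torus that is symmetric under `rho`, which
acts on the vertices by `j ↦ 7 - j`, and of whose 16 triangles exactly those in `hullFaces` lie in
the boundary of the convex hull. -/
structure IsPupTent (P : Config) : Prop where
  paper : IsPaperTorus P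
  symmetric : ∀ j, P (7 - j) = rho (P j)
  hull : ∀ s ∈ faces, cell P s ⊆ frontier (convexHull ℝ (Set.range P)) ↔ s ∈ hullFaces

/-- No four vertices are coplanar. -/
def InGeneralPosition (P : Config) : Prop :=
  ∀ s : Finset (ZMod 8), s.card = 4 → AffineIndependent ℝ (fun i : s => P i)

/-! ### The space of similarity classes of pup tents -/

/-- Similarity (of the labelled vertex configurations) as an equivalence relation. -/
instance similarSetoid : Setoid {P : Config // IsPupTent P} where
  r P Q := Similar P.1 Q.1
  iseqv := ⟨fun P => Similar.refl P.1, fun h => h.symm, fun h h' => h.trans h'⟩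

/-- The space of similarity classes of pup tents, with the quotient topology. -/
abbrev Space : Type := Quotient similarSetoid

/-- A similarity class consists of pup tents in general position. -/
def Space.InGeneralPosition (T : Space) : Prop :=
  ∀ P : {P : Config // IsPupTent P}, (⟦P⟧ : Space) = T → PupTent.InGeneralPosition P.1

/-! ### The modular surface and the flat structure -/

/-- The modular surface `ℍ / SL₂(ℤ)`. -/
abbrev ModularSurface : Type := MulAction.orbitRel.Quotient SL(2, ℤ) UpperHalfPlane

/-- The point of the modular surface represented by `τ`. -/
def toModularSurface (τ : UpperHalfPlane) : ModularSurface :=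
  Quotient.mk (MulAction.orbitRel SL(2, ℤ) UpperHalfPlane) τ

/-- The bi-cusped fundamental domain: the closed geodesic triangle in `ℍ` with vertex
`1/2 + (√3/2) i` and cusps `0` and `∞`. -/
def biCuspedDomain : Set UpperHalfPlane :=
  {z | 0 ≤ z.re ∧ z.re ≤ 1 / 2 ∧ 1 ≤ ‖(z : ℂ) - 1‖}

/-- The interior of the bi-cusped fundamental domain, as a subset of the modular surface. -/
def biCuspedInterior : Set ModularSurface := toModularSurface '' interior biCuspedDomain

/-- The universal cover of the uniform triangulation is the standard triangulation of the plane with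
vertex set `ℤ × ℤ` and positively oriented triangles `v, v + (1,0), v + (1,1)` and
`v, v + (1,1), v + (0,1)`. This is the projection of its vertices to those of the torus; it
maps the two types of triangles to `{a, a+2, a+3}` and `{a, a+1, a+3}`. The deck group is
its kernel, which has the positively oriented basis `(1,-2), (3,2)`. -/
def label (v : ℤ × ℤ) : ZMod 8 := ((2 * v.1 + v.2 : ℤ) : ZMod 8)

/-- The points `A, B, C` of the plane span a positively (counterclockwise) oriented triangle. -/
def PositivelyOriented (A B C : ℂ) : Prop := 0 < ((starRingEnd ℂ) (B - A) * (C - A)).im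

/-- `D` gives the vertices of a developing map of the intrinsic metric of the torus `P`: the
triangles of the universal cover are laid out in the plane isometrically and with coherent
orientation, and the deck group acts by the lattice of translations generated by `ω₁, ω₂`.
Thus the underlying flat torus of `P` is `ℂ / (ℤ ω₁ + ℤ ω₂)`. -/
structure IsDevelopment (P : Config) (D : ℤ × ℤ → ℂ) (ω₁ ω₂ : ℂ) : Prop where
  isometric : ∀ v, ∀ e ∈ ({(1, 0), (0, 1), (1, 1)} : Set (ℤ × ℤ)),
    dist (D v) (D (v + e)) = dist (P (label v)) (P (label (v + e)))
  oriented_lower : ∀ v, PositivelyOriented (D v) (D (v + (1, 0))) (D (v + (1, 1)))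
  oriented_upper : ∀ v, PositivelyOriented (D v) (D (v + (1, 1))) (D (v + (0, 1)))
  translation₁ : ∀ v, D (v + (1, -2)) = D v + ω₁
  translation₂ : ∀ v, D (v + (3, 2)) = D v + ω₂

/-- The point `m` of the modular surface represents the flat structure of the pup tents in the
similarity class `T`. -/
def HasModulus (T : Space) (m : ModularSurface) : Prop :=
  ∃ P : {P : Config // IsPupTent P}, (⟦P⟧ : Space) = T ∧
    ∃ (D : ℤ × ℤ → ℂ) (ω₁ ω₂ : ℂ) (τ : UpperHalfPlane), IsDevelopment P.1 D ω₁ ω₂ ∧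
      ω₁ ≠ 0 ∧ ω₂ = (τ : ℂ) * ω₁ ∧ toModularSurface τ = m

instance : Nonempty ModularSurface := ⟨toModularSurface UpperHalfPlane.I⟩

/-- The modulus map: it sends a similarity class of pup tents to the (unique) point of the modular
surface that represents the underlying flat structure. -/
def Phi (T : Space) : ModularSurface := Classical.epsilon (HasModulus T)

end PupTent

end

noncomputable section

namespace PupTent

/-! ### Signed volumes and the order type of a configuration -/

/-! Everything combinatorial about a pup tent depends only on its order type, that is, on the signs
of the volumes of its vertex tetrahedra. If these signs agree with those of one integral model
(`HasModelSigns`), then general position, embeddedness and the pattern of hull triangles follow from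
finite checks on the model (`HasModelSigns.isEmbedded`, `HasModelSigns.hull`). Flatness and the
modulus are treated through a developing map. Around each vertex the developed triangles turn
through a positive multiple of `2π`, while Gauss–Bonnet fixes the total, so every cone angle is
exactly `2π` (`IsDevelopment.coneAngle_eq`). The periods of the development give the modulus.

It remains to find, for every `τ = x + y * I` in the interior of the bi-cusped domain, a symmetric
configuration with the right order type and a development with periods `2` and `2τ`. Such
configurations are perturbations of degenerate ones. In a collapsed tent the vertices `1, …, 6` lie
in a horizontal plane, the vertices `0, 7` hang at depth `h` below it, and the developed and spatial
edge lengths already agree. Explicit formulas give a collapsed tent for each `τ`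
(`collapsedTent_base`).

Once the lattice, the point `A` and the heights are prescribed, matching the edge lengths amounts to
twelve equations in twelve unknowns. Their linearization at a collapsed tent is a triangular system
of small invertible blocks (`CollapsedTent.eq_zero_of_edgeDerivative`), so the implicit function
theorem solves them when the vertices `2, 3, 4, 5` are raised by heights proportional to a small `s`
(`exists_section`). Tetrahedra that use `0` or `7` keep their sign by continuity. Those among `1, …,
6` degenerate in the limit, but their volumes are `s` times quantities that stay positive at the
limit (`vol_tent_eq_mul`, `CollapsedTent.vol_inner_pos`). Hence every small `s > 0` gives a pup
tent.

The local solution families overlap for nearby `τ` by uniqueness in the implicit function theorem,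
and the domain of `τ` is connected; so the pieces form one path-connected family that attains every
modulus (`exists_isPathConnected_family`). -/

/-- Six times the signed volume of the tetrahedron `A B C X`. -/
def vol (A B C X : E3) : ℝ :=
  (B 0 - A 0) * ((C 1 - A 1) * (X 2 - A 2) - (C 2 - A 2) * (X 1 - A 1)) -
    (B 1 - A 1) * ((C 0 - A 0) * (X 2 - A 2) - (C 2 - A 2) * (X 0 - A 0)) +
    (B 2 - A 2) * ((C 0 - A 0) * (X 1 - A 1) - (C 1 - A 1) * (X 0 - A 0))

/-- An integral configuration with the order type of the pup tents to be constructed. -/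
def modelPoint : Fin 8 → Fin 3 → ℤ :=
  ![![-3, 0, -3], ![4, -1, 0], ![4, -4, 2], ![-2, -4, 1],
    ![2, 4, 1], ![-4, 4, 2], ![-4, 1, 0], ![3, 0, -3]]

/-- Six times the signed volume of a tetrahedron of the model configuration. -/
def modelVol (a b c d : ZMod 8) : ℤ :=
  let A := modelPoint a
  let B := modelPoint b
  let C := modelPoint c
  let X := modelPoint d
  (B 0 - A 0) * ((C 1 - A 1) * (X 2 - A 2) - (C 2 - A 2) * (X 1 - A 1)) -
    (B 1 - A 1) * ((C 0 - A 0) * (X 2 - A 2) - (C 2 - A 2) * (X 0 - A 0)) +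
    (B 2 - A 2) * ((C 0 - A 0) * (X 1 - A 1) - (C 1 - A 1) * (X 0 - A 0))

/-- The configuration has the order type of the model. -/
def HasModelSigns (P : Config) : Prop :=
  ∀ a b c d, SignType.sign (vol (P a) (P b) (P c) (P d)) = SignType.sign (modelVol a b c d)

/-- Positively oriented tetrahedra of the model with vertices among `1, …, 6`, one for each orbit
of the symmetry. -/
def innerQuads : List (ZMod 8 × ZMod 8 × ZMod 8 × ZMod 8) :=
  [(1, 3, 2, 4), (1, 3, 2, 5), (1, 3, 2, 6), (1, 2, 4, 5), (1, 2, 4, 6), (1, 2, 5, 6),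
   (1, 3, 4, 5), (1, 3, 4, 6), (2, 4, 3, 5)]

/-- Positively oriented tetrahedra of the model with one of the vertices `0, 7`, one for each orbit
of the symmetry. -/
def outerQuads : List (ZMod 8 × ZMod 8 × ZMod 8 × ZMod 8) :=
  [(0, 2, 1, 3), (0, 2, 1, 4), (0, 2, 1, 5), (0, 2, 1, 6), (0, 1, 2, 7), (0, 3, 1, 4),
   (0, 3, 1, 5), (0, 3, 1, 6), (0, 1, 3, 7), (0, 1, 4, 5), (0, 1, 4, 6), (0, 4, 1, 7),
   (0, 1, 5, 6), (0, 5, 1, 7), (0, 6, 1, 7), (0, 3, 2, 4), (0, 3, 2, 5), (0, 3, 2, 6),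
   (0, 2, 3, 7), (0, 2, 4, 5), (0, 2, 4, 6), (0, 4, 2, 7), (0, 2, 5, 6), (0, 5, 2, 7),
   (0, 3, 4, 5), (0, 3, 4, 6), (0, 4, 3, 7), (0, 3, 5, 6), (0, 4, 5, 6)]

lemma vol_swap₁₂ (A B C X : E3) : vol B A C X = -vol A B C X := by unfold vol; ring
lemma vol_swap₂₃ (A B C X : E3) : vol A C B X = -vol A B C X := by unfold vol; ring
lemma vol_swap₃₄ (A B C X : E3) : vol A B X C = -vol A B C X := by unfold vol; ring
lemma modelVol_swap₁₂ (a b c d : ZMod 8) : modelVol b a c d = -modelVol a b c d := by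
  unfold modelVol; ring
lemma modelVol_swap₂₃ (a b c d : ZMod 8) : modelVol a c b d = -modelVol a b c d := by
  unfold modelVol; ring
lemma modelVol_swap₃₄ (a b c d : ZMod 8) : modelVol a b d c = -modelVol a b c d := by
  unfold modelVol; ring

lemma vol_rho (A B C X : E3) : vol (rho A) (rho B) (rho C) (rho X) = vol A B C X := by
  simp [vol, rho]; ring

/-- Both volumes are alternating in their four arguments. Sorting by transpositions changes both
signs alike, and a repeated argument makes both vanish. -/
lemma hasModelSigns_of_sorted {P : Config}
    (h : ∀ a b c d : ZMod 8, a.val < b.val → b.val < c.val → c.val < d.val →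
      SignType.sign (vol (P a) (P b) (P c) (P d)) = SignType.sign (modelVol a b c d)) :
    HasModelSigns P := by
  set Q : ZMod 8 → ZMod 8 → ZMod 8 → ZMod 8 → Prop := fun a b c d =>
    SignType.sign (vol (P a) (P b) (P c) (P d)) = SignType.sign (modelVol a b c d) with hQ
  have s12 : ∀ a b c d, Q b a c d → Q a b c d := fun a b c d hq => by
    simp only [hQ] at hq ⊢
    rw [vol_swap₁₂, modelVol_swap₁₂, Left.sign_neg, Left.sign_neg, hq]
  have s23 : ∀ a b c d, Q a c b d → Q a b c d := fun a b c d hq => by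
    simp only [hQ] at hq ⊢
    rw [vol_swap₂₃, modelVol_swap₂₃, Left.sign_neg, Left.sign_neg, hq]
  have s34 : ∀ a b c d, Q a b d c → Q a b c d := fun a b c d hq => by
    simp only [hQ] at hq ⊢
    rw [vol_swap₃₄, modelVol_swap₃₄, Left.sign_neg, Left.sign_neg, hq]
  have e12 : ∀ a c d, Q a a c d := fun a c d => by
    simp only [hQ]
    have h1 : vol (P a) (P a) (P c) (P d) = 0 := by unfold vol; ring
    have h2 : modelVol a a c d = 0 := by unfold modelVol; ring
    rw [h1, h2, sign_zero, sign_zero]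
  have e23 : ∀ a b d, Q a b b d := fun a b d => s12 _ _ _ _ (s23 _ _ _ _ (e12 b a d))
  have e34 : ∀ a b c, Q a b c c := fun a b c => s23 _ _ _ _ (s34 _ _ _ _ (e23 a c b))
  have val_inj : ∀ a b : ZMod 8, a.val = b.val → a = b := fun a b h => ZMod.val_injective 8 h
  have h3 : ∀ a b c d : ZMod 8, a.val < b.val → b.val < c.val → Q a b c d := by
    intro a b c d hab hbc
    rcases lt_trichotomy c.val d.val with h' | h' | h'
    · exact h a b c d hab hbc h'
    · rw [val_inj _ _ h']; exact e34 _ _ _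
    refine s34 _ _ _ _ ?_
    rcases lt_trichotomy b.val d.val with h'' | h'' | h''
    · exact h _ _ _ _ hab h'' h'
    · rw [val_inj _ _ h'']; exact e23 _ _ _
    refine s23 _ _ _ _ ?_
    rcases lt_trichotomy a.val d.val with h3 | h3 | h3
    · exact h _ _ _ _ h3 h'' hbc
    · rw [val_inj _ _ h3]; exact e12 _ _ _
    exact s12 _ _ _ _ (h _ _ _ _ h3 hab hbc)
  have h2 : ∀ a b c d : ZMod 8, a.val < b.val → Q a b c d := by
    intro a b c d hab
    rcases lt_trichotomy b.val c.val with h' | h' | h'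
    · exact h3 a b c d hab h'
    · rw [val_inj _ _ h']; exact e23 _ _ _
    refine s23 _ _ _ _ ?_
    rcases lt_trichotomy a.val c.val with h'' | h'' | h''
    · exact h3 _ _ _ _ h'' h'
    · rw [val_inj _ _ h'']; exact e12 _ _ _
    exact s12 _ _ _ _ (h3 _ _ _ _ h'' hab)
  intro a b c d
  change Q a b c d
  rcases lt_trichotomy a.val b.val with h' | h' | h'
  · exact h2 _ _ _ _ h'
  · rw [val_inj _ _ h']; exact e12 _ _ _
  · exact s12 _ _ _ _ (h2 _ _ _ _ h')

/-- By symmetry it suffices to check the orientation of one tetrahedron in each orbit. -/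
lemma HasModelSigns.of_quads {P : Config} (hρ : ∀ j, P (7 - j) = rho (P j))
    (h : ∀ q ∈ innerQuads ++ outerQuads, 0 < vol (P q.1) (P q.2.1) (P q.2.2.1) (P q.2.2.2)) :
    HasModelSigns P := by
  refine hasModelSigns_of_sorted fun a b c d hab hbc hcd => ?_
  have hrev : ∀ a b c d : ZMod 8, vol (P a) (P b) (P c) (P d) =
      vol (P (7 - a)) (P (7 - b)) (P (7 - c)) (P (7 - d)) := fun a b c d => by
    rw [hρ, hρ, hρ, hρ, vol_rho]
  -- The lists hold one positively ordered quadruple for each orbit of `j ↦ 7 - j` on 4-subsets. For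
  -- a negative sorted quadruple the listed order has the middle two entries exchanged.
  have key : ∀ a b c d : ZMod 8, a.val < b.val → b.val < c.val → c.val < d.val →
      (0 < modelVol a b c d ∧ ((a, b, c, d) ∈ innerQuads ++ outerQuads ∨
        (7 - d, 7 - c, 7 - b, 7 - a) ∈ innerQuads ++ outerQuads)) ∨
      (modelVol a b c d < 0 ∧ ((a, c, b, d) ∈ innerQuads ++ outerQuads ∨
        (7 - d, 7 - b, 7 - c, 7 - a) ∈ innerQuads ++ outerQuads)) := by
    decide +kernel
  rcases key a b c d hab hbc hcd with ⟨hm, h' | h'⟩ | ⟨hm, h' | h'⟩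
  · rw [sign_pos hm, sign_pos (h _ h')]
  · have := h _ h'
    dsimp only at this
    -- The rotation reverses the order of the labels. Six transpositions undo the reversal, which is
    -- an even permutation, so the sign is kept.
    rw [← hrev, vol_swap₃₄, vol_swap₂₃, vol_swap₁₂, vol_swap₃₄, vol_swap₂₃, vol_swap₃₄] at this
    rw [sign_pos hm, sign_pos (by linarith)]
  · have := h _ h'
    dsimp only at this
    rw [vol_swap₂₃] at this
    rw [sign_neg hm, sign_neg (by linarith)]
  · have := h _ h'
    dsimp only at this
    rw [← hrev, vol_swap₃₄, vol_swap₂₃, vol_swap₁₂, vol_swap₃₄, vol_swap₂₃, vol_swap₃₄,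
      vol_swap₂₃] at this
    rw [sign_neg hm, sign_neg (by linarith)]

namespace HasModelSigns


lemma vol_nonneg {P : Config} (h : HasModelSigns P) {a b c d : ZMod 8}
    (hm : 0 ≤ modelVol a b c d) :
    0 ≤ vol (P a) (P b) (P c) (P d) := by
  rw [← sign_nonneg_iff, h, sign_nonneg_iff]; exact hm

lemma vol_nonpos {P : Config} (h : HasModelSigns P) {a b c d : ZMod 8}
    (hm : modelVol a b c d ≤ 0) :
    vol (P a) (P b) (P c) (P d) ≤ 0 := by
  rw [← sign_nonpos_iff, h, sign_nonpos_iff]; exact hm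

lemma vol_pos {P : Config} (h : HasModelSigns P) {a b c d : ZMod 8}
    (hm : 0 < modelVol a b c d) :
    0 < vol (P a) (P b) (P c) (P d) := by
  rw [← sign_eq_one_iff, h, sign_eq_one_iff]; exact hm

lemma vol_neg {P : Config} (h : HasModelSigns P) {a b c d : ZMod 8}
    (hm : modelVol a b c d < 0) :
    vol (P a) (P b) (P c) (P d) < 0 := by
  rw [← sign_eq_neg_one_iff, h, sign_eq_neg_one_iff]; exact hm

lemma vol_ne_zero {P : Config} (h : HasModelSigns P) {a b c d : ZMod 8}
    (hm : modelVol a b c d ≠ 0) :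
    vol (P a) (P b) (P c) (P d) ≠ 0 := by
  rw [← sign_ne_zero, h, sign_ne_zero]; exact hm

end HasModelSigns

/-! ### Affine geometry of a configuration with the order type of the model -/

lemma vol_eq_affine (A B C : E3) :
    ∃ N₀ N₁ N₂ c : ℝ, ∀ X : E3, vol A B C X = N₀ * X 0 + N₁ * X 1 + N₂ * X 2 + c := by
  refine ⟨(B 1 - A 1) * (C 2 - A 2) - (B 2 - A 2) * (C 1 - A 1),
    (B 2 - A 2) * (C 0 - A 0) - (B 0 - A 0) * (C 2 - A 2),
    (B 0 - A 0) * (C 1 - A 1) - (B 1 - A 1) * (C 0 - A 0),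
    -(((B 1 - A 1) * (C 2 - A 2) - (B 2 - A 2) * (C 1 - A 1)) * A 0 +
    ((B 2 - A 2) * (C 0 - A 0) - (B 0 - A 0) * (C 2 - A 2)) * A 1 +
    ((B 0 - A 0) * (C 1 - A 1) - (B 1 - A 1) * (C 0 - A 0)) * A 2), fun X => ?_⟩
  unfold vol
  ring

lemma sum_smul_apply {ι : Type*} (s : Finset ι) (w : ι → ℝ) (p : ι → E3) (k : Fin 3) :
    (∑ i ∈ s, w i • p i) k = ∑ i ∈ s, w i * p i k := by
  simp

/-- `vol A B C` is affine in its last argument. -/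
lemma sum_mul_vol {ι : Type*} (s : Finset ι) (w : ι → ℝ) (p : ι → E3) (A B C X : E3)
    (hX : ∑ i ∈ s, w i • p i = (∑ i ∈ s, w i) • X) :
    ∑ i ∈ s, w i * vol A B C (p i) = (∑ i ∈ s, w i) * vol A B C X := by
  obtain ⟨N₀, N₁, N₂, c, hv⟩ := vol_eq_affine A B C
  have hk : ∀ k : Fin 3, ∑ i ∈ s, w i * p i k = (∑ i ∈ s, w i) * X k := fun k => by
    rw [← sum_smul_apply, hX]; simp
  simp only [hv]
  calc ∑ i ∈ s, w i * (N₀ * p i 0 + N₁ * p i 1 + N₂ * p i 2 + c)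
      = N₀ * ∑ i ∈ s, w i * p i 0 + N₁ * ∑ i ∈ s, w i * p i 1 + N₂ * ∑ i ∈ s, w i * p i 2
        + (∑ i ∈ s, w i) * c := by
        simp only [Finset.mul_sum, Finset.sum_mul, ← Finset.sum_add_distrib]
        exact Finset.sum_congr rfl fun i _ => by ring
    _ = _ := by rw [hk, hk, hk]; ring

lemma mem_cell_iff {P : Config} {s : Finset (ZMod 8)} {x : E3} :
    x ∈ cell P s ↔ ∃ w : ZMod 8 → ℝ, (∀ i ∈ s, 0 ≤ w i) ∧ ∑ i ∈ s, w i = 1 ∧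
      ∑ i ∈ s, w i • P i = x := by
  classical
  constructor
  · intro hx
    have : convexHull ℝ (P '' (s : Set (ZMod 8))) ⊆ {x | ∃ w : ZMod 8 → ℝ, (∀ i ∈ s, 0 ≤ w i) ∧
        ∑ i ∈ s, w i = 1 ∧ ∑ i ∈ s, w i • P i = x} := by
      refine convexHull_min ?_ ?_
      · rintro _ ⟨i, hi, rfl⟩
        refine ⟨Pi.single i 1, fun j _ => ?_, ?_, ?_⟩
        · by_cases h : j = i
          · subst h; simp
          · simp [h]
        · rw [Finset.sum_eq_single_of_mem i hi fun j _ hj => by simp [hj]]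
          simp
        · rw [Finset.sum_eq_single_of_mem i hi fun j _ hj => by simp [hj]]
          simp
      · rintro _ ⟨w, hw, hw1, rfl⟩ _ ⟨v, hv, hv1, rfl⟩ a b ha hb hab
        refine ⟨fun i => a * w i + b * v i, fun i hi => ?_, ?_, ?_⟩
        · have := hw i hi
          have := hv i hi
          positivity
        · rw [Finset.sum_add_distrib, ← Finset.mul_sum, ← Finset.mul_sum, hw1, hv1]; linarith
        · simp only [add_smul, Finset.sum_add_distrib, mul_smul, Finset.smul_sum]
    exact this hx
  · rintro ⟨w, hw, hw1, rfl⟩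
    exact (convex_convexHull ℝ _).sum_mem hw hw1 fun i hi =>
      subset_convexHull ℝ _ (Set.mem_image_of_mem P hi)

lemma modelVol_ne_zero : ∀ a b c d : ZMod 8, a ≠ b → a ≠ c → b ≠ c → d ≠ a → d ≠ b → d ≠ c →
    modelVol a b c d ≠ 0 := by
  decide +kernel

lemma vol_self₁ (A B C : E3) : vol A B C A = 0 := by unfold vol; ring
lemma vol_self₂ (A B C : E3) : vol A B C B = 0 := by unfold vol; ring
lemma vol_self₃ (A B C : E3) : vol A B C C = 0 := by unfold vol; ring

namespace HasModelSigns

/-- Affine relations between at most four vertices are trivial. -/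
lemma eq_zero_of_sum_eq_zero {P : Config} (h : HasModelSigns P) {s : Finset (ZMod 8)}
    (hs : s.card ≤ 4) {w : ZMod 8 → ℝ} (h0 : ∑ i ∈ s, w i = 0) (h1 : ∑ i ∈ s, w i • P i = 0) :
    ∀ i ∈ s, w i = 0 := by
  classical
  intro i hi
  -- Pad `s` to four vertices and call the three other than `i` by `a, b, c`. The affine function
  -- `vol (P a) (P b) (P c)` applied to the relation kills every term except that of `i`, where it
  -- is nonzero.
  obtain ⟨t, hst, -, ht⟩ := Finset.exists_subsuperset_card_eq (n := 4) (Finset.subset_univ s) hs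
    (by simp [ZMod.card])
  have hit : i ∈ t := hst hi
  obtain ⟨a, b, c, hab, hac, hbc, he⟩ := Finset.card_eq_three.1
    (show (t.erase i).card = 3 by rw [Finset.card_erase_of_mem hit, ht])
  have hmem : ∀ j, j ∈ t.erase i ↔ j = a ∨ j = b ∨ j = c := fun j => by rw [he]; simp
  have hia : i ≠ a := fun hh => Finset.notMem_erase i t ((hmem i).2 (Or.inl hh))
  have hib : i ≠ b := fun hh => Finset.notMem_erase i t ((hmem i).2 (Or.inr (Or.inl hh)))
  have hic : i ≠ c := fun hh => Finset.notMem_erase i t ((hmem i).2 (Or.inr (Or.inr hh)))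
  have hne := h.vol_ne_zero (modelVol_ne_zero a b c i hab hac hbc hia hib hic)
  have hsum := sum_mul_vol s w P (P a) (P b) (P c) 0 (by rw [h0, h1]; simp)
  rw [h0, zero_mul, Finset.sum_eq_single_of_mem i hi] at hsum
  · exact (mul_eq_zero.1 hsum).resolve_right hne
  · intro j hj hji
    rcases (hmem j).1 (Finset.mem_erase.2 ⟨hji, hst hj⟩) with rfl | rfl | rfl
    · rw [vol_self₁, mul_zero]
    · rw [vol_self₂, mul_zero]
    · rw [vol_self₃, mul_zero]

lemma affineIndependent {P : Config} (h : HasModelSigns P) {s : Finset (ZMod 8)}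
    (hs : s.card ≤ 4) : AffineIndependent ℝ (fun i : s => P i) := by
  classical
  rw [affineIndependent_iff]
  intro t w h0 h1 i hi
  set w' : ZMod 8 → ℝ := fun j => if hj : j ∈ s then (if ⟨j, hj⟩ ∈ t then w ⟨j, hj⟩ else 0) else 0
  have hw' : ∀ j : s, w' j = if j ∈ t then w j else 0 := fun j => by simp [w']
  have e0 : ∑ j ∈ s, w' j = 0 := by
    rw [← Finset.sum_coe_sort s]
    simp only [hw', Finset.sum_ite_mem, Finset.univ_inter, h0]
  have e1 : ∑ j ∈ s, w' j • P j = 0 := by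
    rw [← Finset.sum_coe_sort s (fun j => w' j • P j)]
    simp only [hw', ite_smul, zero_smul, Finset.sum_ite_mem, Finset.univ_inter]
    exact h1
  have := h.eq_zero_of_sum_eq_zero hs e0 e1 i i.2
  rw [hw', if_pos hi] at this
  exact this

lemma inGeneralPosition {P : Config} (h : HasModelSigns P) : InGeneralPosition P :=
  fun _ hs => h.affineIndependent hs.le

/-- A finite check on the model: any two triangles are weakly separated by a plane through three
vertices. Since the statement involves only signs, it passes to every configuration with the same
order type. -/
lemma faces_separated : ∀ s ∈ faces, ∀ t ∈ faces, s ≠ t → ∃ a b c : ZMod 8, a ≠ b ∧ a ≠ c ∧ b ≠ c ∧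
    (∀ v ∈ s, 0 ≤ modelVol a b c v) ∧ (∀ v ∈ t, modelVol a b c v ≤ 0) := by
  decide +kernel

lemma card_of_mem_faces : ∀ s ∈ faces, s.card = 3 := by decide +kernel

/-- If a convex combination of vertices on one side of a plane lies in the plane, only the vertices
in the plane contribute. -/
lemma weight_eq_zero {s : Finset (ZMod 8)} {w v : ZMod 8 → ℝ} (hw : ∀ i ∈ s, 0 ≤ w i)
    (hv : ∀ i ∈ s, 0 ≤ v i) (h : ∑ i ∈ s, w i * v i = 0) {i : ZMod 8} (hi : i ∈ s)
    (hvi : v i ≠ 0) : w i = 0 := by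
  have := (Finset.sum_eq_zero_iff_of_nonneg fun j hj => mul_nonneg (hw j hj) (hv j hj)).1 h i hi
  exact (mul_eq_zero.1 this).resolve_right hvi

/-- A common point of two triangles lies on their separating plane, so in both barycentric
representations only the vertices `a, b, c` of that plane carry weight. These are affinely
independent, so the two representations coincide and are supported on the common vertices. -/
lemma isEmbedded {P : Config} (h : HasModelSigns P) : IsEmbedded P := by
  classical
  refine ⟨fun s hs => h.affineIndependent (by rw [card_of_mem_faces s hs]; norm_num),
    fun s hs t ht => ?_⟩
  rcases eq_or_ne s t with rfl | hst
  · simp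
  obtain ⟨a, b, c, hab, hac, hbc, hsa, hta⟩ := faces_separated s hs t ht hst
  rintro x ⟨hxs, hxt⟩
  obtain ⟨w, hw, hw1, hwx⟩ := mem_cell_iff.1 hxs
  obtain ⟨v, hv, hv1, hvx⟩ := mem_cell_iff.1 hxt
  set V : ZMod 8 → ℝ := fun i => vol (P a) (P b) (P c) (P i) with hV
  have ew := sum_mul_vol s w P (P a) (P b) (P c) x (by rw [hw1, one_smul, hwx])
  have ev := sum_mul_vol t v P (P a) (P b) (P c) x (by rw [hv1, one_smul, hvx])
  rw [hw1, one_mul] at ew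
  rw [hv1, one_mul] at ev
  have hVs : ∀ i ∈ s, 0 ≤ V i := fun i hi => h.vol_nonneg (hsa i hi)
  have hVt : ∀ i ∈ t, V i ≤ 0 := fun i hi => h.vol_nonpos (hta i hi)
  have hx0 : vol (P a) (P b) (P c) x = 0 := by
    refine le_antisymm ?_ ?_
    · rw [← ev]; exact Finset.sum_nonpos fun i hi => mul_nonpos_of_nonneg_of_nonpos (hv i hi)
        (hVt i hi)
    · rw [← ew]; exact Finset.sum_nonneg fun i hi => mul_nonneg (hw i hi) (hVs i hi)
  have hVne : ∀ i, i ∉ ({a, b, c} : Finset (ZMod 8)) → V i ≠ 0 := fun i hi => by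
    simp only [Finset.mem_insert, Finset.mem_singleton, not_or] at hi
    exact h.vol_ne_zero (modelVol_ne_zero a b c i hab hac hbc hi.1 hi.2.1 hi.2.2)
  have hw0 : ∀ i ∈ s, i ∉ ({a, b, c} : Finset (ZMod 8)) → w i = 0 := fun i hi hi' =>
    weight_eq_zero hw hVs (ew.trans hx0) hi (hVne i hi')
  have hv0 : ∀ i ∈ t, i ∉ ({a, b, c} : Finset (ZMod 8)) → v i = 0 := fun i hi hi' =>
    weight_eq_zero (v := fun i => -V i) hv (fun i hi => neg_nonneg.2 (hVt i hi))
      (by simp only [mul_neg, Finset.sum_neg_distrib]; rw [ev, hx0, neg_zero]) hi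
      (neg_ne_zero.2 (hVne i hi'))
  -- compare the two representations of `x` by vertices of the separating plane
  set Z : Finset (ZMod 8) := {a, b, c}
  have restrict : ∀ (u : Finset (ZMod 8)) (w : ZMod 8 → ℝ), (∀ i ∈ u, i ∉ Z → w i = 0) →
      ∑ i ∈ Z, (if i ∈ u then w i else 0) = ∑ i ∈ u, w i ∧
      ∑ i ∈ Z, (if i ∈ u then w i else 0) • P i = ∑ i ∈ u, w i • P i := by
    intro u w hu
    simp only [ite_smul, zero_smul, Finset.sum_ite_mem]
    constructor
    · refine Finset.sum_subset Finset.inter_subset_right fun i hi hi' => hu i hi fun hZ => ?_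
      exact hi' (Finset.mem_inter.2 ⟨hZ, hi⟩)
    · refine Finset.sum_subset Finset.inter_subset_right fun i hi hi' => ?_
      rw [hu i hi fun hZ => hi' (Finset.mem_inter.2 ⟨hZ, hi⟩), zero_smul]
  obtain ⟨rs1, rs2⟩ := restrict s w hw0
  obtain ⟨rt1, rt2⟩ := restrict t v hv0
  have heq := h.eq_zero_of_sum_eq_zero (s := Z)
    (w := fun i => (if i ∈ s then w i else 0) - (if i ∈ t then v i else 0))
    (by rw [show Z.card = 3 from Finset.card_eq_three.2 ⟨a, b, c, hab, hac, hbc, rfl⟩]; norm_num)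
    (by rw [Finset.sum_sub_distrib, rs1, rt1, hw1, hv1, sub_self])
    (by simp only [sub_smul]; rw [Finset.sum_sub_distrib, rs2, rt2, hwx, hvx, sub_self])
  have hsupp : ∀ i ∈ s, i ∉ s ∩ t → w i = 0 := by
    intro i hi hi'
    by_cases hZ : i ∈ Z
    · have := heq i hZ
      have hit : i ∉ t := fun hit => hi' (Finset.mem_inter.2 ⟨hi, hit⟩)
      simpa [hi, hit] using this
    · exact hw0 i hi hZ
  refine mem_cell_iff.2 ⟨w, fun i hi => hw i (Finset.mem_inter.1 hi).1, ?_, ?_⟩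
  · rw [← hw1]
    exact Finset.sum_subset Finset.inter_subset_left hsupp
  · rw [← hwx]
    exact Finset.sum_subset Finset.inter_subset_left fun i hi hi' => by
      rw [hsupp i hi hi', zero_smul]

end HasModelSigns

/-! ### The convex hull -/

/-- Cramer's rule. -/
lemma vol_cramer (A B C U X : E3) (k : Fin 3) :
    vol A B C U * (X k - A k) = vol A X C U * (B k - A k) + vol A B X U * (C k - A k) +
      vol A B C X * (U k - A k) := by
  fin_cases k <;> simp only [vol, Fin.zero_eta, Fin.mk_one, Fin.reduceFinMk] <;> ring

/-- The coordinates of `X` in the frame at `A` are ratios of volumes. Thus the values of a linear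
functional on a tetrahedron determine its values everywhere, with coefficients whose signs are
known. -/
lemma map_vol_cramer (f : E3 →L[ℝ] ℝ) (A B C U X : E3) :
    vol A B C U * (f X - f A) = vol A X C U * (f B - f A) + vol A B X U * (f C - f A) +
      vol A B C X * (f U - f A) := by
  have : vol A B C U • (X - A) = vol A X C U • (B - A) + vol A B X U • (C - A) +
      vol A B C X • (U - A) := by
    ext k
    simpa using vol_cramer A B C U X k
  simpa using congrArg f this

lemma cell_subset_convexHull (P : Config) (s : Finset (ZMod 8)) :
    cell P s ⊆ convexHull ℝ (Set.range P) :=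
  convexHull_mono (Set.image_subset_range _ _)

lemma vol_nonneg_of_mem_convexHull {P : Config} {A B C : E3} (h : ∀ i, 0 ≤ vol A B C (P i))
    {x : E3} (hx : x ∈ convexHull ℝ (Set.range P)) : 0 ≤ vol A B C x := by
  have hx' : x ∈ cell P Finset.univ := by simpa [cell] using hx
  obtain ⟨w, hw, hw1, rfl⟩ := mem_cell_iff.1 hx'
  have := sum_mul_vol Finset.univ w P A B C (∑ i, w i • P i) (by rw [hw1, one_smul])
  rw [hw1, one_mul] at this
  rw [← this]
  exact Finset.sum_nonneg fun i hi => mul_nonneg (hw i hi) (h i)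

/-- A triangle spanning a supporting plane lies in the boundary of the convex hull. -/
lemma cell_subset_frontier {P : Config} {a b c d : ZMod 8}
    (h : ∀ i, 0 ≤ vol (P a) (P b) (P c) (P i)) (hd : 0 < vol (P a) (P b) (P c) (P d)) :
    cell P {a, b, c} ⊆ frontier (convexHull ℝ (Set.range P)) := by
  intro x hx
  have hxH := cell_subset_convexHull P _ hx
  have hx0 : vol (P a) (P b) (P c) x = 0 := by
    obtain ⟨w, hw, hw1, rfl⟩ := mem_cell_iff.1 hx
    have := sum_mul_vol {a, b, c} w P (P a) (P b) (P c) _ (by rw [hw1, one_smul])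
    rw [hw1, one_mul] at this
    rw [← this]
    refine Finset.sum_eq_zero fun i hi => ?_
    simp only [Finset.mem_insert, Finset.mem_singleton] at hi
    rcases hi with rfl | rfl | rfl
    · rw [vol_self₁, mul_zero]
    · rw [vol_self₂, mul_zero]
    · rw [vol_self₃, mul_zero]
  refine ⟨subset_closure hxH, fun hint => ?_⟩
  obtain ⟨N₀, N₁, N₂, k, hv⟩ := vol_eq_affine (P a) (P b) (P c)
  -- From an interior point on the supporting plane one could move slightly away from `P d` and stay
  -- in the hull, but this crosses to the negative side.
  have hcont : Continuous fun t : ℝ => x + t • (x - P d) := by fun_prop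
  have hmem : ∀ᶠ t : ℝ in nhds 0, x + t • (x - P d) ∈ interior (convexHull ℝ (Set.range P)) := by
    refine hcont.continuousAt.eventually_mem ?_
    simpa using isOpen_interior.mem_nhds hint
  obtain ⟨t, ht, htpos⟩ := ((hmem.filter_mono nhdsWithin_le_nhds).and
    (self_mem_nhdsWithin : Set.Ioi (0 : ℝ) ∈ nhdsWithin 0 (Set.Ioi 0))).exists
  have hge := vol_nonneg_of_mem_convexHull h (interior_subset ht)
  have he : vol (P a) (P b) (P c) (x + t • (x - P d)) =
      vol (P a) (P b) (P c) x + t * (vol (P a) (P b) (P c) x - vol (P a) (P b) (P c) (P d)) := by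
    simp only [hv]
    simp
    ring
  rw [he, hx0] at hge
  have htpos' : 0 < t := htpos
  nlinarith [mul_pos htpos' hd]

/-- A triangle whose plane separates two vertices strictly does not lie in the boundary of the
convex hull. -/
lemma not_cell_subset_frontier {P : Config} {a b c u v : ZMod 8} (hab : a ≠ b) (hac : a ≠ c)
    (hbc : b ≠ c) (hu : 0 < vol (P a) (P b) (P c) (P u)) (hv : vol (P a) (P b) (P c) (P v) < 0)
    (hne : (interior (convexHull ℝ (Set.range P))).Nonempty) :
    ¬ cell P {a, b, c} ⊆ frontier (convexHull ℝ (Set.range P)) := by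
  intro hsub
  set H := convexHull ℝ (Set.range P) with hH
  have hconv : Convex ℝ H := convex_convexHull ℝ _
  -- A functional supporting the hull at the barycentre of the triangle is constant on the triangle.
  -- Since `P u` and `P v` lie on opposite sides of its plane, Cramer's rule forces the functional
  -- to be constant on the whole space, contradicting strictness in the interior.
  set x : E3 := (1 / 3 : ℝ) • P a + (1 / 3 : ℝ) • P b + (1 / 3 : ℝ) • P c with hx
  have hxc : x ∈ cell P {a, b, c} := by
    refine mem_cell_iff.2 ⟨fun _ => 1 / 3, fun i _ => by norm_num, ?_, ?_⟩
    · rw [Finset.sum_const, Finset.card_eq_three.2 ⟨a, b, c, hab, hac, hbc, rfl⟩]; norm_num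
    · rw [Finset.sum_insert (by simp [hab, hac]), Finset.sum_insert (by simp [hbc]),
        Finset.sum_singleton, hx, add_assoc]
  have hxi : x ∉ interior H := (hsub hxc).2
  obtain ⟨f, hf⟩ := geometric_hahn_banach_open_point hconv.interior isOpen_interior hxi
  have hle : ∀ i, f (P i) ≤ f x := by
    intro i
    have hi : P i ∈ closure (interior H) := by
      rw [hconv.closure_interior_eq_closure_of_nonempty_interior hne]
      exact subset_closure (subset_convexHull ℝ _ (Set.mem_range_self i))
    exact closure_minimal (s := interior H) (t := {y | f y ≤ f x}) (fun y hy => (hf y hy).le)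
      (isClosed_le f.continuous continuous_const) hi
  have hfx : f x = (1 / 3) * f (P a) + (1 / 3) * f (P b) + (1 / 3) * f (P c) := by
    simp [hx]
  have ha := hle a
  have hb := hle b
  have hc := hle c
  have hfb : f (P b) - f (P a) = 0 := by linarith
  have hfc : f (P c) - f (P a) = 0 := by linarith
  have hxa : f x = f (P a) := by linarith
  have hcr := map_vol_cramer f (P a) (P b) (P c) (P u) (P v)
  rw [hfb, hfc, mul_zero, mul_zero, zero_add, zero_add] at hcr
  have hfu : f (P u) - f (P a) = 0 := by
    have h1 := hle u
    have h2 := hle v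
    have h3 : vol (P a) (P b) (P c) (P v) * (f (P u) - f (P a)) = 0 := by
      refine le_antisymm ?_ (mul_nonneg_of_nonpos_of_nonpos hv.le (by linarith))
      rw [← hcr]
      exact mul_nonpos_of_nonneg_of_nonpos hu.le (by linarith)
    exact (mul_eq_zero.1 h3).resolve_left hv.ne
  obtain ⟨y, hy⟩ := hne
  have hcr' := map_vol_cramer f (P a) (P b) (P c) (P u) y
  rw [hfb, hfc, hfu, mul_zero, mul_zero, mul_zero, add_zero, add_zero] at hcr'
  have := hf y hy
  rw [hxa] at this
  have h0 := (mul_eq_zero.1 hcr').resolve_left hu.ne'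
  linarith

namespace HasModelSigns

lemma interior_convexHull_nonempty {P : Config} (h : HasModelSigns P) :
    (interior (convexHull ℝ (Set.range P))).Nonempty := by
  have hai := h.affineIndependent (s := {0, 1, 2, 3}) (by decide)
  have htop : affineSpan ℝ (Set.range fun i : ({0, 1, 2, 3} : Finset (ZMod 8)) => P i) = ⊤ := by
    rw [hai.affineSpan_eq_top_iff_card_eq_finrank_add_one]
    simp only [finrank_euclideanSpace, Fintype.card_coe, Fintype.card_fin]
    decide
  refine (interior_convexHull_nonempty_iff_affineSpan_eq_top.2 htop).mono
    (interior_mono (convexHull_mono ?_))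
  rintro _ ⟨i, rfl⟩
  exact Set.mem_range_self _

/-- For each hull triangle, the order of the vertices is chosen so that the model lies on the
nonnegative side. -/
lemma exists_supporting : ∀ s ∈ hullFaces, ∃ a b c d : ZMod 8, s = {a, b, c} ∧
    (∀ i, 0 ≤ modelVol a b c i) ∧ 0 < modelVol a b c d := by
  decide +kernel

/-- The planes of the ten other triangles have model vertices strictly on both sides. -/
lemma exists_separated : ∀ s ∈ faces, s ∉ hullFaces → ∃ a b c u v : ZMod 8, s = {a, b, c} ∧
    a ≠ b ∧ a ≠ c ∧ b ≠ c ∧ 0 < modelVol a b c u ∧ modelVol a b c v < 0 := by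
  decide +kernel

lemma hull {P : Config} (h : HasModelSigns P) :
    ∀ s ∈ faces, cell P s ⊆ frontier (convexHull ℝ (Set.range P)) ↔ s ∈ hullFaces := by
  intro s hs
  constructor
  · intro hsub
    by_contra hns
    obtain ⟨a, b, c, u, v, rfl, hab, hac, hbc, hu, hv⟩ := exists_separated s hs hns
    exact not_cell_subset_frontier hab hac hbc (h.vol_pos hu) (h.vol_neg hv)
      h.interior_convexHull_nonempty hsub
  · intro hsh
    obtain ⟨a, b, c, d, rfl, hi, hd⟩ := exists_supporting s hsh
    exact cell_subset_frontier (fun i => h.vol_nonneg (hi i)) (h.vol_pos hd)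

end HasModelSigns

/-! ### Developed configurations are flat -/

/-- The angle of a triangle is determined by its side lengths. -/
lemma angle_eq_of_dist_eq {V W : Type*} [NormedAddCommGroup V] [InnerProductSpace ℝ V]
    [NormedAddCommGroup W] [InnerProductSpace ℝ W] {a b c : V} {a' b' c' : W}
    (hab : dist b a = dist b' a') (hbc : dist b c = dist b' c') (hac : dist a c = dist a' c') :
    EuclideanGeometry.angle a b c = EuclideanGeometry.angle a' b' c' := by
  unfold EuclideanGeometry.angle InnerProductGeometry.angle
  rw [real_inner_eq_norm_mul_self_add_norm_mul_self_sub_norm_sub_mul_self_div_two,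
    real_inner_eq_norm_mul_self_add_norm_mul_self_sub_norm_sub_mul_self_div_two]
  simp only [vsub_eq_sub, sub_sub_sub_cancel_right, ← dist_eq_norm]
  rw [dist_comm a b, dist_comm a' b', dist_comm c b, dist_comm c' b', hab, hbc, hac]

/-- Orientation turns the unoriented angle into an argument of a quotient, so that sums of angles
around a vertex telescope modulo `2π`. -/
lemma angle_eq_arg_div {z w : ℂ} (h : 0 < ((starRingEnd ℂ) z * w).im) :
    InnerProductGeometry.angle w z = (w / z).arg ∧ 0 < (w / z).arg := by
  have hz : z ≠ 0 := by rintro rfl; simp at h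
  have hw : w ≠ 0 := by rintro rfl; simp at h
  have him : 0 < (w / z).im := by
    have : w / z = ((Complex.normSq z)⁻¹ : ℝ) * ((starRingEnd ℂ) z * w) := by
      rw [div_eq_mul_inv, Complex.inv_def]; push_cast; ring
    rw [this, Complex.im_ofReal_mul]
    exact mul_pos (inv_pos.2 (Complex.normSq_pos.2 hz)) h
  have hpos : 0 < (w / z).arg := by
    refine lt_of_le_of_ne (Complex.arg_nonneg_iff.2 him.le) fun h0 => ?_
    have := (Complex.arg_eq_zero_iff.1 h0.symm).2
    exact him.ne' this
  exact ⟨by rw [Complex.angle_eq_abs_arg hw hz, abs_of_pos hpos], hpos⟩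

/-- The angle sum of a cyclic sequence of negatively oriented triangles is at least `2π`. -/
lemma two_pi_le_sum_angle {z : Fin 6 → ℂ}
    (h : ∀ k, 0 < ((starRingEnd ℂ) (z (k + 1)) * z k).im) :
    2 * Real.pi ≤ ∑ k, InnerProductGeometry.angle (z k) (z (k + 1)) := by
  have hne : ∀ k, z k ≠ 0 := fun k hk => by
    have := h k
    rw [hk] at this
    simp at this
  have hsum : ∑ k, InnerProductGeometry.angle (z k) (z (k + 1)) = ∑ k, (z k / z (k + 1)).arg :=
    Finset.sum_congr rfl fun k _ => (angle_eq_arg_div (h k)).1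
  have hpos : 0 < ∑ k, (z k / z (k + 1)).arg :=
    Finset.sum_pos (fun k _ => (angle_eq_arg_div (h k)).2) Finset.univ_nonempty
  -- The product of the quotients around the cycle is `1`, so the angle sum is an integral multiple
  -- of `2π`; being positive, it is at least one full turn.
  have hcoe : ((∑ k, (z k / z (k + 1)).arg : ℝ) : Real.Angle) = ((0 : ℝ) : Real.Angle) := by
    have h1 : ∀ k, ((z k / z (k + 1)).arg : Real.Angle) =
        ((z k).arg : Real.Angle) - ((z (k + 1)).arg : Real.Angle) := fun k =>
      Complex.arg_div_coe_angle (hne k) (hne (k + 1))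
    rw [show ((∑ k, (z k / z (k + 1)).arg : ℝ) : Real.Angle) =
      ∑ k, ((z k / z (k + 1)).arg : Real.Angle) from map_sum Real.Angle.coeHom _ _]
    simp only [h1]
    have h2 : ∑ k, ((z (k + 1)).arg : Real.Angle) = ∑ k, ((z k).arg : Real.Angle) :=
      Equiv.sum_comp (Equiv.addRight (1 : Fin 6)) fun k => ((z k).arg : Real.Angle)
    rw [Finset.sum_sub_distrib, h2, sub_self, Real.Angle.coe_zero]
  obtain ⟨n, hn⟩ := Real.Angle.angle_eq_iff_two_pi_dvd_sub.1 hcoe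
  rw [sub_zero] at hn
  rw [hsum, hn]
  rw [hn] at hpos
  have hnpos : 0 < (n : ℝ) := by
    by_contra hcon
    have := mul_nonpos_of_nonneg_of_nonpos Real.two_pi_pos.le (not_lt.1 hcon)
    linarith
  have h1 : (1 : ℝ) ≤ n := by exact_mod_cast (by exact_mod_cast hnpos : (0 : ℤ) < n)
  nlinarith [Real.two_pi_pos]

lemma PositivelyOriented.rotate {A B C : ℂ} (h : PositivelyOriented A B C) :
    PositivelyOriented B C A := by
  unfold PositivelyOriented at *
  simp only [Complex.mul_im, Complex.conj_re, Complex.conj_im, Complex.sub_re,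
    Complex.sub_im] at *
  linarith

lemma PositivelyOriented.ne {A B C : ℂ} (h : PositivelyOriented A B C) : B ≠ A := by
  rintro rfl
  simp [PositivelyOriented] at h

/-- The offsets in the universal cover of the neighbours of a vertex. -/
def offset : Fin 6 → ℤ × ℤ := ![(0, 1), (1, 1), (1, 0), (0, -1), (-1, -1), (-1, 0)]

lemma label_add (v w : ℤ × ℤ) : label (v + w) = label v + label w := by
  simp only [label, Prod.fst_add, Prod.snd_add]
  push_cast
  ring

lemma label_offset (k : Fin 6) : label (offset k) = link k := by
  fin_cases k <;> rfl

lemma exists_label_eq (j : ZMod 8) : ∃ v, label v = j :=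
  ⟨(0, j.val), by simp [label]⟩

namespace IsDevelopment

variable {P : Config} {D : ℤ × ℤ → ℂ} {ω₁ ω₂ : ℂ}

lemma dist_neg (h : IsDevelopment P D ω₁ ω₂) (v : ℤ × ℤ) {e : ℤ × ℤ}
    (he : e ∈ ({(1, 0), (0, 1), (1, 1)} : Set (ℤ × ℤ))) :
    dist (D v) (D (v + -e)) = dist (P (label v)) (P (label (v + -e))) := by
  have := h.isometric (v + -e) e he
  rw [neg_add_cancel_right] at this
  rw [dist_comm, this, dist_comm]

lemma dist_offset (h : IsDevelopment P D ω₁ ω₂) (v : ℤ × ℤ) (k : Fin 6) :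
    dist (D v) (D (v + offset k)) = dist (P (label v)) (P (label v + link k)) := by
  rw [← label_offset, ← label_add]
  fin_cases k
  · exact h.isometric v (0, 1) (by simp)
  · exact h.isometric v (1, 1) (by simp)
  · exact h.isometric v (1, 0) (by simp)
  · exact h.dist_neg v (e := (0, 1)) (by simp)
  · exact h.dist_neg v (e := (1, 1)) (by simp)
  · exact h.dist_neg v (e := (1, 0)) (by simp)

lemma dist_offset_offset (h : IsDevelopment P D ω₁ ω₂) (v : ℤ × ℤ) (k : Fin 6) :
    dist (D (v + offset k)) (D (v + offset (k + 1))) =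
      dist (P (label v + link k)) (P (label v + link (k + 1))) := by
  have key : ∃ l : Fin 6, offset (k + 1) = offset k + offset l := by
    revert k; decide
  obtain ⟨l, hl⟩ := key
  have h1 := h.dist_offset (v + offset k) l
  rw [add_assoc, ← hl, label_add, label_offset] at h1
  rw [h1, add_assoc (label v), ← label_offset, ← label_offset, ← label_offset, ← label_add (offset
      k), ← hl]

/-- The offsets run clockwise. The six triangles at a vertex are three lower and three upper
triangles based at neighbouring lattice points, rotated to start at `v`. -/
lemma oriented_offset (h : IsDevelopment P D ω₁ ω₂) (v : ℤ × ℤ) (k : Fin 6) :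
    PositivelyOriented (D v) (D (v + offset (k + 1))) (D (v + offset k)) := by
  have e : ∀ a b c d : ℤ, (v + (a, b)) + (c, d) = v + (a + c, b + d) := fun a b c d => by
    rw [add_assoc]; rfl
  have e0 : v + ((0, 0) : ℤ × ℤ) = v := add_zero v
  fin_cases k
  · exact h.oriented_upper v
  · exact h.oriented_lower v
  · have := h.oriented_upper (v + (0, -1))
    simp only [e] at this
    norm_num [e0] at this
    exact this.rotate.rotate
  · have := h.oriented_lower (v + (-1, -1))
    simp only [e] at this
    norm_num [e0] at this
    exact this.rotate.rotate
  · have := h.oriented_upper (v + (-1, -1))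
    simp only [e] at this
    norm_num [e0] at this
    exact this.rotate
  · have := h.oriented_lower (v + (-1, 0))
    simp only [e] at this
    norm_num [e0] at this
    exact this.rotate

lemma two_pi_le_coneAngle (h : IsDevelopment P D ω₁ ω₂) (j : ZMod 8) :
    2 * Real.pi ≤ coneAngle P j := by
  obtain ⟨v, rfl⟩ := exists_label_eq j
  have := two_pi_le_sum_angle (z := fun k => D (v + offset k) - D v) fun k => h.oriented_offset v k
  refine this.trans_eq (Finset.sum_congr rfl fun k _ => ?_)
  exact angle_eq_of_dist_eq (a := D (v + offset k)) (b := D v) (c := D (v + offset (k + 1)))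
    (h.dist_offset v k) (h.dist_offset v (k + 1)) (h.dist_offset_offset v k)

lemma ne (h : IsDevelopment P D ω₁ ω₂) (j : ZMod 8) (k : Fin 6) : P (j + link k) ≠ P j := by
  obtain ⟨v, rfl⟩ := exists_label_eq j
  have h1 := (h.oriented_offset v k).rotate.rotate.ne
  have h2 := h.dist_offset v k
  intro heq
  rw [heq, dist_self] at h2
  exact h1 (dist_eq_zero.1 h2)

/-- The Gauss–Bonnet theorem for the uniform triangulation. -/
lemma sum_coneAngle (h : IsDevelopment P D ω₁ ω₂) : ∑ j, coneAngle P j = 16 * Real.pi := by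
  have shift : ∀ (c : ZMod 8) (f : ZMod 8 → ℝ), ∑ j, f j = ∑ j, f (j + c) := fun c f =>
    (Equiv.sum_comp (Equiv.addRight c) f).symm
  unfold coneAngle
  simp only [Fin.sum_univ_six, Finset.sum_add_distrib]
  -- Reindexing the sum brings together the three angles of each triangle `{j, j+1, j+3}` and `{j,
  -- j+2, j+3}`.
  rw [shift 1 fun j => EuclideanGeometry.angle (P (j + link 2)) (P j) (P (j + link (2 + 1))),
    shift 3 fun j => EuclideanGeometry.angle (P (j + link 4)) (P j) (P (j + link (4 + 1))),
    shift 3 fun j => EuclideanGeometry.angle (P (j + link 3)) (P j) (P (j + link (3 + 1))),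
    shift 2 fun j => EuclideanGeometry.angle (P (j + link 5)) (P j) (P (j + link (5 + 1)))]
  have hA : ∀ j : ZMod 8, EuclideanGeometry.angle (P (j + link 0)) (P j) (P (j + link (0 + 1))) +
      EuclideanGeometry.angle (P (j + 1 + link 2)) (P (j + 1)) (P (j + 1 + link (2 + 1))) +
      EuclideanGeometry.angle (P (j + 3 + link 4)) (P (j + 3)) (P (j + 3 + link (4 + 1))) =
      Real.pi := fun j => by
    have e1 : j + link 0 = j + 1 := rfl
    have e2 : j + link (0 + 1) = j + 3 := rfl
    have e3 : j + 1 + link 2 = j + 3 := by rw [add_assoc]; rfl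
    have e4 : j + 1 + link (2 + 1) = j := by rw [add_assoc]; exact add_zero j
    have e5 : j + 3 + link 4 = j := by rw [add_assoc]; exact add_zero j
    have e6 : j + 3 + link (4 + 1) = j + 1 := by rw [add_assoc]; rfl
    rw [e1, e2, e3, e4, e5, e6]
    have hne : P (j + 1) ≠ P j := h.ne j 0
    have := EuclideanGeometry.angle_add_angle_add_angle_eq_pi (P (j + 3)) hne
    rw [EuclideanGeometry.angle_comm (P (j + 1)) (P j), EuclideanGeometry.angle_comm (P (j + 3))
      (P (j + 1)), EuclideanGeometry.angle_comm (P j) (P (j + 3))]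
    linarith
  have hB : ∀ j : ZMod 8, EuclideanGeometry.angle (P (j + link 1)) (P j) (P (j + link (1 + 1))) +
      EuclideanGeometry.angle (P (j + 2 + link 5)) (P (j + 2)) (P (j + 2 + link (5 + 1))) +
      EuclideanGeometry.angle (P (j + 3 + link 3)) (P (j + 3)) (P (j + 3 + link (3 + 1))) =
      Real.pi := fun j => by
    have e1 : j + link 1 = j + 3 := rfl
    have e2 : j + link (1 + 1) = j + 2 := rfl
    have e3 : j + 2 + link 5 = j := by rw [add_assoc]; exact add_zero j
    have e4 : j + 2 + link (5 + 1) = j + 3 := by rw [add_assoc]; rfl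
    have e5 : j + 3 + link 3 = j + 2 := by rw [add_assoc]; rfl
    have e6 : j + 3 + link (3 + 1) = j := by rw [add_assoc]; exact add_zero j
    rw [e1, e2, e3, e4, e5, e6]
    have hne : P (j + 2) ≠ P j := h.ne j 2
    have := EuclideanGeometry.angle_add_angle_add_angle_eq_pi (P (j + 3)) hne
    linarith
  have hA' := Finset.sum_congr (rfl : (Finset.univ : Finset (ZMod 8)) = _) fun j _ => hA j
  have hB' := Finset.sum_congr (rfl : (Finset.univ : Finset (ZMod 8)) = _) fun j _ => hB j
  simp only [Finset.sum_add_distrib] at hA' hB'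
  have hc : ∑ _j : ZMod 8, Real.pi = 8 * Real.pi := by
    rw [Finset.sum_const, Finset.card_univ, ZMod.card, nsmul_eq_mul]; norm_num
  rw [hc] at hA' hB'
  linarith

/-- A configuration with a development is flat. -/
lemma coneAngle_eq (h : IsDevelopment P D ω₁ ω₂) (j : ZMod 8) : coneAngle P j = 2 * Real.pi := by
  have hsum : ∑ j, (coneAngle P j - 2 * Real.pi) = 0 := by
    rw [Finset.sum_sub_distrib, h.sum_coneAngle, Finset.sum_const, Finset.card_univ, ZMod.card,
      nsmul_eq_mul]
    push_cast
    ring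
  -- The excesses over `2π` are nonnegative and sum to zero, so each vanishes.
  have := (Finset.sum_eq_zero_iff_of_nonneg fun j _ => sub_nonneg.2 (h.two_pi_le_coneAngle j)).1
    hsum j (Finset.mem_univ j)
  linarith

end IsDevelopment

/-- The order type supplies embeddedness and the hull pattern; the development supplies flatness. -/
lemma isPupTent_of_hasModelSigns {P : Config} {D : ℤ × ℤ → ℂ} {ω₁ ω₂ : ℂ}
    (hsym : ∀ j, P (7 - j) = rho (P j)) (hs : HasModelSigns P) (hD : IsDevelopment P D ω₁ ω₂) :
    IsPupTent P :=
  ⟨⟨hs.isEmbedded, hD.coneAngle_eq⟩, hsym, hs.hull⟩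

/-! ### Similarity invariance -/

/-- The squared norm of a combination with total weight zero is a quadratic form in the weights
whose coefficients are squared distances. A similarity multiplies the form by a constant, so the
same weights annihilate both families. -/
lemma _root_.Similar.affineIndependent {ι V W : Type*} [NormedAddCommGroup V]
    [InnerProductSpace ℝ V] [NormedAddCommGroup W] [InnerProductSpace ℝ W] {p : ι → V} {q : ι → W}
    (h : Similar p q) (hp : AffineIndependent ℝ p) : AffineIndependent ℝ q := by
  obtain ⟨r, hr, hd⟩ := similar_iff_exists_dist_eq.1 h
  intro s w hw hs
  refine hp s w hw ?_
  have h1 := EuclideanGeometry.inner_weightedVSub p hw p hw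
  have h2 := EuclideanGeometry.inner_weightedVSub q hw q hw
  rw [hs, inner_zero_left] at h2
  have h3 : ∑ i ∈ s, ∑ j ∈ s, w i * w j * (dist (p i) (p j) * dist (p i) (p j)) =
      r ^ 2 * ∑ i ∈ s, ∑ j ∈ s, w i * w j * (dist (q i) (q j) * dist (q i) (q j)) := by
    rw [Finset.mul_sum]
    refine Finset.sum_congr rfl fun i _ => ?_
    rw [Finset.mul_sum]
    refine Finset.sum_congr rfl fun j _ => ?_
    rw [hd i j]
    ring
  have h4 : ∑ i ∈ s, ∑ j ∈ s, w i * w j * (dist (q i) (q j) * dist (q i) (q j)) = 0 := by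
    linarith
  rw [h3, h4] at h1
  simpa using h1

lemma Space.inGeneralPosition_mk {P : {P : Config // IsPupTent P}}
    (h : PupTent.InGeneralPosition P.1) : Space.InGeneralPosition ⟦P⟧ := by
  intro Q hQ s hs
  have hsim : Similar Q.1 P.1 := Quotient.exact hQ
  exact (hsim.symm.index_map (fun i : s => (i : ZMod 8))).affineIndependent (h s hs)

/-! ### Uniqueness of the modulus -/

/-- Two similar triangles with the same orientation are related by a complex linear map. -/
lemma mul_eq_mul_of_norm_eq {a b a' b' : ℂ} {r : ℝ} (hr : r ≠ 0) (ha : ‖a'‖ = r * ‖a‖)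
    (hb : ‖b'‖ = r * ‖b‖) (hab : ‖a' - b'‖ = r * ‖a - b‖)
    (h : 0 < ((starRingEnd ℂ) a * b).im) (h' : 0 < ((starRingEnd ℂ) a' * b').im) :
    a' * b = a * b' := by
  have n1 : Complex.normSq a' = r ^ 2 * Complex.normSq a := by
    rw [Complex.normSq_eq_norm_sq, Complex.normSq_eq_norm_sq, ha]; ring
  have n2 : Complex.normSq b' = r ^ 2 * Complex.normSq b := by
    rw [Complex.normSq_eq_norm_sq, Complex.normSq_eq_norm_sq, hb]; ring
  have n3 : Complex.normSq (a' - b') = r ^ 2 * Complex.normSq (a - b) := by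
    rw [Complex.normSq_eq_norm_sq, Complex.normSq_eq_norm_sq, hab]; ring
  have hre : ((starRingEnd ℂ) a' * b').re = r ^ 2 * ((starRingEnd ℂ) a * b).re := by
    simp only [Complex.normSq_apply, Complex.sub_re, Complex.sub_im, Complex.mul_re,
      Complex.conj_re, Complex.conj_im] at *
    linarith
  have hsq : Complex.normSq ((starRingEnd ℂ) a' * b') =
      r ^ 4 * Complex.normSq ((starRingEnd ℂ) a * b) := by
    rw [Complex.normSq_mul, Complex.normSq_mul, Complex.normSq_conj, Complex.normSq_conj, n1, n2]
    ring
  -- Polarization fixes the real part of the Hermitian product and the norms fix its modulus, so the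
  -- imaginary part is known up to sign; the orientations decide the sign.
  have him : ((starRingEnd ℂ) a' * b').im = r ^ 2 * ((starRingEnd ℂ) a * b).im := by
    rw [Complex.normSq_apply, Complex.normSq_apply, hre] at hsq
    have hpos := mul_pos (by positivity : 0 < r ^ 2) h
    have : (((starRingEnd ℂ) a' * b').im - r ^ 2 * ((starRingEnd ℂ) a * b).im) *
        (((starRingEnd ℂ) a' * b').im + r ^ 2 * ((starRingEnd ℂ) a * b).im) = 0 := by linarith
    rcases mul_eq_zero.1 this with h0 | h0 <;> linarith
  have key : (starRingEnd ℂ) a' * b' = (r ^ 2 : ℝ) * ((starRingEnd ℂ) a * b) := by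
    apply Complex.ext
    · rw [hre, Complex.re_ofReal_mul]
    · rw [him, Complex.im_ofReal_mul]
  have ha0 : a ≠ 0 := by rintro rfl; simp at h
  have hc : ((r ^ 2 : ℝ) : ℂ) * (starRingEnd ℂ) a ≠ 0 :=
    mul_ne_zero (Complex.ofReal_ne_zero.2 (by positivity)) ((map_ne_zero _).2 ha0)
  apply mul_left_cancel₀ hc
  have e1 : a' * (starRingEnd ℂ) a' = (r ^ 2 : ℝ) * (a * (starRingEnd ℂ) a) := by
    rw [Complex.mul_conj, Complex.mul_conj, n1]; push_cast; ring
  calc (r ^ 2 : ℝ) * (starRingEnd ℂ) a * (a' * b)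
      = a' * ((r ^ 2 : ℝ) * ((starRingEnd ℂ) a * b)) := by ring
    _ = (a' * (starRingEnd ℂ) a') * b' := by rw [← key]; ring
    _ = (r ^ 2 : ℝ) * (starRingEnd ℂ) a * (a * b') := by rw [e1]; ring

/-- A function on `ℤ × ℤ` that is invariant under the two unit translations is constant. -/
lemma eq_of_forall_add_eq {X : Type*} {f : ℤ × ℤ → X} (h₁ : ∀ v, f (v + (1, 0)) = f v)
    (h₂ : ∀ v, f (v + (0, 1)) = f v) (v w : ℤ × ℤ) : f v = f w := by
  have a1 : ∀ m n : ℤ, f (m, n) = f (0, n) := fun m n => by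
    induction m using Int.induction_on with
    | zero => rfl
    | succ k ih => rw [← ih, ← h₁ (k, n)]; simp
    | pred k ih => rw [← ih, ← h₁]; simp
  have a2 : ∀ n : ℤ, f (0, n) = f (0, 0) := fun n => by
    induction n using Int.induction_on with
    | zero => rfl
    | succ k ih => rw [← ih, ← h₂ (0, k)]; simp
    | pred k ih => rw [← ih, ← h₂]; simp
  rw [← Prod.mk.eta (p := v), ← Prod.mk.eta (p := w), a1, a2, a1 w.1, a2 w.2]

namespace IsDevelopment

variable {P Q : Config} {D E : ℤ × ℤ → ℂ} {ω₁ ω₂ η₁ η₂ : ℂ}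

lemma dist_upper (h : IsDevelopment P D ω₁ ω₂) (v : ℤ × ℤ) :
    dist (D (v + (1, 1))) (D (v + (1, 0))) = dist (P (label (v + (1, 1)))) (P (label (v + (1, 0))))
        := by
  have := h.isometric (v + (1, 0)) (0, 1) (by simp)
  rw [add_assoc] at this
  rw [dist_comm, dist_comm (P _)]
  exact this

lemma dist_lower (h : IsDevelopment P D ω₁ ω₂) (v : ℤ × ℤ) :
    dist (D (v + (0, 1))) (D (v + (1, 1))) = dist (P (label (v + (0, 1)))) (P (label (v + (1, 1))))
        := by
  have := h.isometric (v + (0, 1)) (1, 0) (by simp)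
  rw [add_assoc] at this
  exact this

/-- Developments of similar configurations are related by a complex affine map. -/
lemma exists_mul_eq (h : IsDevelopment P D ω₁ ω₂) (h' : IsDevelopment Q E η₁ η₂)
    (hPQ : Similar Q P) : ∃ ζ : ℂ, ζ ≠ 0 ∧ ∀ v w, E v - E w = ζ * (D v - D w) := by
  obtain ⟨r, hr, hd⟩ := similar_iff_exists_dist_eq.1 hPQ
  have hr' : (r : ℝ) ≠ 0 := by exact_mod_cast hr
  have hD1 : ∀ v, D (v + (1, 0)) - D v ≠ 0 := fun v => sub_ne_zero.2 (h.oriented_lower v).ne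
  have hD2 : ∀ v, D (v + (1, 1)) - D v ≠ 0 := fun v => sub_ne_zero.2 (h.oriented_upper v).ne
  have hE1 : ∀ v, E (v + (1, 0)) - E v ≠ 0 := fun v => sub_ne_zero.2 (h'.oriented_lower v).ne
  have step : ∀ v, ∀ e ∈ ({(1, 0), (0, 1), (1, 1)} : Set (ℤ × ℤ)),
      ‖E (v + e) - E v‖ = r * ‖D (v + e) - D v‖ := fun v e he => by
    rw [← dist_eq_norm, ← dist_eq_norm, dist_comm, h'.isometric v e he, hd, dist_comm (D _),
      h.isometric v e he]
  -- `Z v` is the complex ratio of the two developments on the triangles at `v`. Neighbouring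
  -- lattice points have triangles with a common edge, which forces the ratio to be constant.
  set Z : ℤ × ℤ → ℂ := fun v => (E (v + (1, 0)) - E v) / (D (v + (1, 0)) - D v) with hZ
  have z10 : ∀ v, E (v + (1, 0)) - E v = Z v * (D (v + (1, 0)) - D v) := fun v => by
    rw [hZ]; field_simp [hD1 v]
  have z11 : ∀ v, E (v + (1, 1)) - E v = Z v * (D (v + (1, 1)) - D v) := fun v => by
    have := mul_eq_mul_of_norm_eq hr' (step v (1, 0) (by simp)) (step v (1, 1) (by simp))
      (by rw [sub_sub_sub_cancel_right, sub_sub_sub_cancel_right, ← dist_eq_norm, ← dist_eq_norm,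
        dist_comm, h'.dist_upper, hd, dist_comm (D _), h.dist_upper])
      (h.oriented_lower v) (h'.oriented_lower v)
    rw [z10 v] at this
    exact mul_left_cancel₀ (hD1 v) (by linear_combination -this)
  have z01 : ∀ v, E (v + (0, 1)) - E v = Z v * (D (v + (0, 1)) - D v) := fun v => by
    have := mul_eq_mul_of_norm_eq hr' (step v (1, 1) (by simp)) (step v (0, 1) (by simp))
      (by rw [sub_sub_sub_cancel_right, sub_sub_sub_cancel_right, ← dist_eq_norm, ← dist_eq_norm,
        dist_comm, h'.dist_lower, hd, dist_comm (D _), h.dist_lower])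
      (h.oriented_upper v) (h'.oriented_upper v)
    rw [z11 v] at this
    exact mul_left_cancel₀ (hD2 v) (by linear_combination -this)
  have hZ1 : ∀ v, Z (v + (1, 0)) = Z v := fun v => by
    have h1 := z01 (v + (1, 0))
    rw [add_assoc, show ((1, 0) + (0, 1) : ℤ × ℤ) = (1, 1) from rfl] at h1
    have hne : D (v + (1, 1)) - D (v + (1, 0)) ≠ 0 :=
      sub_ne_zero.2 (h.oriented_lower v).rotate.ne
    exact mul_right_cancel₀ hne (by linear_combination z11 v - z10 v - h1)
  have hZ2 : ∀ v, Z (v + (0, 1)) = Z v := fun v => by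
    have h1 := z10 (v + (0, 1))
    rw [add_assoc, show ((0, 1) + (1, 0) : ℤ × ℤ) = (1, 1) from rfl] at h1
    have hne : D (v + (1, 1)) - D (v + (0, 1)) ≠ 0 :=
      sub_ne_zero.2 (h.oriented_upper v).rotate.ne.symm
    exact mul_right_cancel₀ hne (by linear_combination z11 v - z01 v - h1)
  have hZc := fun v => eq_of_forall_add_eq hZ1 hZ2 v 0
  refine ⟨Z 0, div_ne_zero (hE1 0) (hD1 0), fun v w => ?_⟩
  have := eq_of_forall_add_eq (f := fun v => E v - Z 0 * D v)
    (fun v => by have := z10 v; rw [hZc v] at this; linear_combination this)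
    (fun v => by have := z01 v; rw [hZc v] at this; linear_combination this) v w
  linear_combination this

lemma translation_eq (h : IsDevelopment P D ω₁ ω₂) (h' : IsDevelopment Q E η₁ η₂)
    (hPQ : Similar Q P) : ∃ ζ : ℂ, ζ ≠ 0 ∧ η₁ = ζ * ω₁ ∧ η₂ = ζ * ω₂ := by
  obtain ⟨ζ, hζ, hDE⟩ := h.exists_mul_eq h' hPQ
  refine ⟨ζ, hζ, ?_, ?_⟩
  · have := hDE (0 + (1, -2)) 0
    rw [h.translation₁, h'.translation₁] at this
    linear_combination this
  · have := hDE (0 + (3, 2)) 0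
    rw [h.translation₂, h'.translation₂] at this
    linear_combination this

end IsDevelopment

/-- Two developments of similar tents differ by a complex affine map, so both periods scale by the
same factor. As the labels mark the lattice, even the two values of `τ` agree, not only their
classes. -/
lemma HasModulus.unique {T : Space} {m m' : ModularSurface} (h : HasModulus T m)
    (h' : HasModulus T m') : m = m' := by
  obtain ⟨P, rfl, D, ω₁, ω₂, τ, hD, h1, h2, rfl⟩ := h
  obtain ⟨Q, hQ, E, η₁, η₂, τ', hE, h1', h2', rfl⟩ := h'
  have hsim : Similar Q.1 P.1 := Quotient.exact hQ
  obtain ⟨ζ, hζ, e1, e2⟩ := hD.translation_eq hE hsim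
  congr 1
  apply UpperHalfPlane.ext
  rw [h2', h2, e1] at e2
  have : (τ' : ℂ) * (ζ * ω₁) = τ * (ζ * ω₁) := by rw [e2]; ring
  exact (mul_right_cancel₀ (mul_ne_zero hζ h1) this).symm

lemma HasModulus.phi_eq {T : Space} {m : ModularSurface} (h : HasModulus T m) : Phi T = m :=
  HasModulus.unique (Classical.epsilon_spec (p := HasModulus T) ⟨m, h⟩) h

lemma HasModulus.iff {T : Space} {m : ModularSurface} (h : HasModulus T m) (m' : ModularSurface) :
    HasModulus T m' ↔ m' = Phi T :=
  ⟨fun h' => h'.phi_eq.symm, fun e => by rw [e, h.phi_eq]; exact h⟩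

/-! ### The collapsed tents -/

/-- The auxiliary parameters of the collapsed tent with half periods `1` and `x + y * I`. -/
structure CollapseParameters (x y κ σ ρ l m : ℝ) : Prop where
  x_pos : 0 < x
  x_lt : x < 1 / 2
  y_pos : 0 < y
  κ_pos : 0 < κ
  κ_lt : κ < x / 4
  κ_lt' : 8 * κ < x ^ 2 + y ^ 2 - 2 * x
  σ_pos : 0 < σ
  σ_lt : σ < x / 5
  ρ_pos : 0 < ρ
  ρ_lt : ρ < 1 / 8
  l_pos : 0 < l
  m_pos : 0 < m
  m_lt : m < 1
  rel_ρ : ρ * (κ + 2 * x) * (1 + κ) = 2 * σ * (1 + κ) + (1 - 2 * x) * κ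
  rel_l : l * ρ * κ = σ
  rel_m : l * (1 - ρ) + m * (1 + ρ) = 1
  lt₁ : ρ * (κ + x) < 1 / 2 - x + σ
  lt₂ : ρ * ((κ + x) * (x ^ 2 + y ^ 2 - x) + (y ^ 2 - (κ + x) ^ 2) / 2) <
    (1 / 2 - x + σ) * (x ^ 2 + y ^ 2 - 2 * x - κ)

/-- The parameter `κ` of the collapsed tent. -/
def kap (x y : ℝ) : ℝ := x * (x ^ 2 + y ^ 2 - 2 * x) / (4 * (x ^ 2 + y ^ 2))

/-- The parameter `σ` of the collapsed tent. -/
def sig (x y : ℝ) : ℝ := (1 - 2 * x) * kap x y ^ 2 / 8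

/-- The parameter `ρ` of the collapsed tent. -/
def rat (x y : ℝ) : ℝ :=
  (2 * sig x y + (1 - 2 * x) * kap x y / (1 + kap x y)) / (kap x y + 2 * x)

/-- The parameter `l` of the collapsed tent. -/
def len (x y : ℝ) : ℝ := sig x y / (rat x y * kap x y)

/-- The parameter `m` of the collapsed tent. -/
def len' (x y : ℝ) : ℝ := (1 - len x y * (1 - rat x y)) / (1 + rat x y)

/-- The half periods with first half period `1` of the interior of the bi-cusped domain. -/
def periodDomain : Set (ℝ × ℝ) := {b | 0 < b.1 ∧ b.1 < 1 / 2 ∧ 0 < b.2 ∧ 2 * b.1 < b.1 ^ 2 + b.2 ^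
    2}

/-- The choice of `κ` makes it small compared with both `x` and `x ^ 2 + y ^ 2 - 2 * x`, the
quantity that vanishes on the circular side of the domain. Then `σ` is of second order in `κ`, while
`ρ`, `l`, `m` are the solutions of the three linear relations in turn. All inequalities follow from
these sizes. -/
lemma collapseParameters {x y : ℝ} (h : (x, y) ∈ periodDomain) :
    CollapseParameters x y (kap x y) (sig x y) (rat x y) (len x y) (len' x y) := by
  obtain ⟨hx, hx2, hy, hn⟩ := h
  simp only at hx hx2 hy hn
  have hn0 : 0 < x ^ 2 + y ^ 2 := by positivity
  have hκe : kap x y * (4 * (x ^ 2 + y ^ 2)) = x * (x ^ 2 + y ^ 2 - 2 * x) := by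
    unfold kap; field_simp
  have hκ : 0 < kap x y := div_pos (mul_pos hx (by linarith)) (by positivity)
  have hσe : sig x y = (1 - 2 * x) * kap x y ^ 2 / 8 := rfl
  have hρe : rat x y * (kap x y + 2 * x) * (1 + kap x y) =
      2 * sig x y * (1 + kap x y) + (1 - 2 * x) * kap x y := by
    unfold rat; field_simp
  have hle : len x y = sig x y / (rat x y * kap x y) := rfl
  have hme : len' x y = (1 - len x y * (1 - rat x y)) / (1 + rat x y) := rfl
  generalize len' x y = m at *
  generalize len x y = l at *
  generalize rat x y = ρ at *
  generalize sig x y = σ at *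
  generalize kap x y = κ at *
  have hs : 0 < 1 - 2 * x := by linarith
  have hκ1 : κ < x / 4 := by
    by_contra hc
    linarith [mul_le_mul_of_nonneg_right (not_lt.1 hc) hn0.le, mul_pos hx hx]
  have hκ2 : 8 * κ < x ^ 2 + y ^ 2 - 2 * x := by
    by_contra hc
    linarith [mul_le_mul_of_nonneg_right (not_lt.1 hc) hn0.le,
      mul_pos (by linarith : 0 < x ^ 2 + y ^ 2 - 2 * x) (by linarith : 0 < x ^ 2 + y ^ 2 - 2 * x)]
  have hσ : 0 < σ := by rw [hσe]; positivity
  have hκ3 : κ < 1 / 8 := by linarith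
  have hσ2 : 8 * σ < κ ^ 2 := by
    rw [hσe]; nlinarith [mul_pos hx (pow_pos hκ 2)]
  have hσ3 : σ < x / 5 := by nlinarith
  have hρ : 0 < ρ := by
    by_contra hc
    have h1 : ρ * (κ + 2 * x) * (1 + κ) ≤ 0 := by
      rw [mul_assoc]
      exact mul_nonpos_of_nonpos_of_nonneg (not_lt.1 hc) (by positivity)
    have h2 : 0 < 2 * σ * (1 + κ) + (1 - 2 * x) * κ := by positivity
    linarith
  have hρ1 : ρ * (κ + 2 * x) ≤ (1 - 2 * x) * κ := by
    have h1 : ρ * (κ + 2 * x) * (1 + κ) ≤ (1 - 2 * x) * κ * (1 + κ) := by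
      rw [hρe, hσe]
      have : 0 ≤ (1 - 2 * x) * κ ^ 2 * (1 - (1 + κ) / 4) :=
        mul_nonneg (by positivity) (by linarith)
      linarith
    exact le_of_mul_le_mul_right h1 (by positivity)
  have hρ2 : ρ < 1 / 8 := by
    by_contra hc
    linarith [mul_le_mul_of_nonneg_right (not_lt.1 hc) (by positivity : 0 ≤ κ + 2 * x),
      mul_pos hx hκ]
  have hl : 0 < l := by rw [hle]; positivity
  have hl1 : l * ρ * κ = σ := by rw [hle]; field_simp
  have hm1 : l * (1 - ρ) + m * (1 + ρ) = 1 := by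
    have : 1 + ρ ≠ 0 := by positivity
    rw [hme]; field_simp; ring
  -- The factor `1 / 8` in `σ` is used here: it keeps `l` below `1`, hence `m` positive.
  have hl2 : l < 1 := by
    have h1 : 8 * σ ≤ ρ * κ * ((κ + 2 * x) * (1 + κ)) := by
      have : 0 ≤ 2 * σ * (1 + κ) * κ := by positivity
      have h2 : 8 * σ = (1 - 2 * x) * κ * κ := by rw [hσe]; ring
      linear_combination this + h2 - κ * hρe
    have h2 : (κ + 2 * x) * (1 + κ) < 2 * 2 :=
      mul_lt_mul'' (by linarith) (by linarith) (by positivity) (by positivity)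
    have h3 : 0 < ρ * κ := by positivity
    by_contra hc
    linarith [mul_le_mul_of_nonneg_right (not_lt.1 hc) h3.le, mul_lt_mul_of_pos_left h2 h3]
  have hm : 0 < m := by
    by_contra hc
    linarith [mul_pos hl hρ, mul_nonneg (neg_nonneg.2 (not_lt.1 hc)) (by positivity : 0 ≤ 1 + ρ)]
  have hm2 : m < 1 := by
    by_contra hc
    linarith [mul_pos hl (by linarith : 0 < 1 - ρ),
      mul_le_mul_of_nonneg_right (not_lt.1 hc) (by positivity : 0 ≤ 1 + ρ)]
  refine ⟨hx, hx2, hy, hκ, hκ1, hκ2, hσ, hσ3, hρ, hρ2, hl, hm, hm2, hρe, hl1, hm1, ?_, ?_⟩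
  · linarith [mul_pos hρ hx, mul_pos hs (by linarith : 0 < 1 / 2 - κ)]
  · set N := x ^ 2 + y ^ 2 - 2 * x with hN
    have hN0 : 0 < N := by linarith
    have h1 : (κ + x) * (x ^ 2 + y ^ 2 - x) + (y ^ 2 - (κ + x) ^ 2) / 2 ≤
        9 / 8 * (x ^ 2 + y ^ 2) := by
      linarith [mul_le_mul_of_nonneg_right (by linarith : κ + x ≤ 5 / 8)
        (by linarith : 0 ≤ x ^ 2 + y ^ 2 - x), sq_nonneg (κ + x), sq_nonneg x]
    have h2 : ρ * (2 * x) ≤ (1 - 2 * x) * κ := by linarith [mul_pos hρ hκ]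
    -- Up to the factor `2 * x`, `ρ` is at most `(1 - 2 * x) * κ`. The definition of `κ` then
    -- cancels `x ^ 2 + y ^ 2` and leaves a small multiple of `N`.
    have h3 : ρ * (9 / 8 * (x ^ 2 + y ^ 2)) ≤ (1 - 2 * x) * (9 / 64 * N) := by
      have h4 : ρ * (2 * x) * (4 * (x ^ 2 + y ^ 2)) ≤ (1 - 2 * x) * (x * N) := by
        rw [← hκe, ← mul_assoc (1 - 2 * x)]
        exact mul_le_mul_of_nonneg_right h2 (by positivity)
      have h5 : x * (8 * ρ * (x ^ 2 + y ^ 2)) ≤ x * ((1 - 2 * x) * N) := by linarith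
      have := le_of_mul_le_mul_left h5 hx
      linarith
    have h4 : (1 / 2 - x) * (7 / 8 * N) ≤ (1 / 2 - x + σ) * (N - κ) :=
      mul_le_mul (by linarith) (by linarith) (by positivity) (by linarith)
    have h5 := mul_le_mul_of_nonneg_left h1 hρ.le
    have h6 : 0 < (1 - 2 * x) * N := by positivity
    linarith

/-- A planar limit of pup tents: the vertices `1, 2, 3` are collapsed to the points `(1 / 2, e)`,
`(c₁, c₂)`, `(-1 / 2, d)` of the horizontal plane and the vertex `0` lies at depth `h` below the
point `(a₁ + q₁, a₂ + q₂)`. -/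
structure CollapsedTent (x y h a₁ a₂ q₁ q₂ e c₁ c₂ d : ℝ) : Prop where
  y_pos : 0 < y
  h_pos : 0 < h
  eq_a : 2 * a₁ = h ^ 2 - 1
  eq_c : 2 * (c₁ * x + c₂ * y) = h ^ 2 - (x ^ 2 + y ^ 2)
  eq_e : 2 * e * y = x - (x ^ 2 + y ^ 2)
  eq_q : 2 * (a₁ * q₁ + a₂ * q₂) + q₁ ^ 2 + q₂ ^ 2 = 0
  eq_qc : q₁ * c₁ + q₂ * c₂ = a₁ * x + a₂ * y
  eq_qe : q₁ / 2 + q₂ * e = a₁ * x + a₂ * y + x - 1 / 2 - a₁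
  eq_d : 2 * (-(q₁ + x) / 2 + d * (q₂ + y)) - 2 * (a₁ * x + a₂ * y) + x ^ 2 + y ^ 2 = h ^ 2
  q_beta : 0 < q₁ * y - q₂ * x
  q_two : 0 < q₂ + y
  cross_T : e + d < 0
  cross₂₁ : 0 < c₁ * e - c₂ / 2
  cross₃₂ : 0 < -c₂ / 2 - d * c₁
  lt_T : c₁ * e - c₂ / 2 < -(e + d) / 2
  T_lt : -(e + d) / 2 < (c₁ * e - c₂ / 2) + (-c₂ / 2 - d * c₁)
  sub_lt : (-c₂ / 2 - d * c₁) - (c₁ * e - c₂ / 2) < -(e + d) / 2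
  cross₀₁ : 0 < (a₁ + q₁) * e - (a₂ + q₂) / 2
  cross_lt₁₂ : (a₁ + q₁) * e - (a₂ + q₂) / 2 < (a₁ + q₁) * c₂ - (a₂ + q₂) * c₁
  cross_lt₂₃ : (a₁ + q₁) * c₂ - (a₂ + q₂) * c₁ < (a₁ + q₁) * d + (a₂ + q₂) / 2
  orient₀ : 0 < (c₁ + 1 / 2) * (d + y - a₂) - (c₂ - d) * (x - 1 / 2 - a₁)
  orient₄ : 0 < d + y - a₂ + (e - d) * (x - 1 / 2 - a₁)
  orient₅ : 0 < (c₁ + x) * a₂ - (c₂ + y) * a₁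
  orient₆ : 0 < (a₁ + 1) * (e + y) - a₂ * (x - 1 / 2)
  orient₇ : 0 < (1 / 2 - c₁) * (c₂ + y + a₂) - (e - c₂) * (c₁ + x + a₁)

/-- The numerator of the orientation condition `orient₆`. Its only negative term is dominated
because `ρ < 1 / 8` and `κ < x / 4`. -/
lemma CollapseParameters.orient₆_pos {x y κ σ ρ l m : ℝ} (H : CollapseParameters x y κ σ ρ l m) :
    0 < (1 / 2 + x - σ) * (x - x ^ 2 + y ^ 2) + (1 - 2 * x) * ((1 / 2 - x + σ) * (κ + x) -
      ρ * ((κ + x) ^ 2 + y ^ 2) / 2) := by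
  obtain ⟨hx, hx2, hy, hκ, hκ1, hκ2, hσ, hσ1, hρ, hρ1, -, -, -, -, -, -, -, -⟩ := H
  have h1 : 0 < (1 / 2 - x + σ) * (κ + x) := by
    have : 0 < 1 / 2 - x + σ := by linarith
    positivity
  have h2 : (κ + x) ^ 2 ≤ (5 / 4 * x) ^ 2 := pow_le_pow_left₀ (by positivity) (by linarith) 2
  have h3 : (x / 4 + y ^ 2) / 2 ≤ (1 / 2 + x - σ) * (x - x ^ 2 + y ^ 2) := by
    have h4 : x / 4 + y ^ 2 ≤ x - x ^ 2 + y ^ 2 := by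
      linarith [mul_pos hx (by linarith : 0 < 1 / 2 - x)]
    linarith [mul_le_mul (by linarith : (1 / 2 : ℝ) ≤ 1 / 2 + x - σ) h4 (by positivity)
      (by linarith)]
  have h4 : ρ * ((κ + x) ^ 2 + y ^ 2) ≤ 1 / 8 * ((5 / 4 * x) ^ 2 + y ^ 2) :=
    mul_le_mul hρ1.le (by linarith) (by positivity) (by norm_num)
  have h5 : (1 - 2 * x) * (ρ * ((κ + x) ^ 2 + y ^ 2)) ≤ 1 * (ρ * ((κ + x) ^ 2 + y ^ 2)) :=
    mul_le_mul_of_nonneg_right (by linarith) (by positivity)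
  linarith [mul_pos (by linarith : 0 < 1 - 2 * x) h1, mul_pos hx (by linarith : 0 < 1 / 2 - x),
    mul_pos hy hy]

set_option maxHeartbeats 1000000 in
-- Put `q = q₁ + q₂ * I` and `τ = x + y * I`, so that `q = ρ * (τ + κ)`. The horizontal steps from
-- vertex `1` to `2` and from `2` to `3` are `l / y` times `τ - q` and `m / y` times `τ + q`, each
-- turned by a right angle; `rel_m` makes the first coordinates close up. After multiplication by
-- `y` or another positive factor, every required inequality becomes an explicit expression in the
-- parameters, in several cases a sum of squares.
lemma CollapseParameters.collapsedTent {x y κ σ ρ l m h a₁ a₂ q₁ q₂ e c₁ c₂ d : ℝ}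
    (H : CollapseParameters x y κ σ ρ l m) (hh : 0 < h) (hh2 : h ^ 2 = 2 * x - 2 * σ)
    (hq₁ : q₁ = ρ * (κ + x)) (hq₂ : q₂ = ρ * y) (ha₁ : a₁ = x - 1 / 2 - σ)
    (ha₂ : a₂ * y = (1 / 2 - x + σ) * (κ + x) - ρ * ((κ + x) ^ 2 + y ^ 2) / 2)
    (he : e * y = (x - (x ^ 2 + y ^ 2)) / 2) (hc₁ : c₁ = 1 / 2 - l * (1 - ρ))
    (hc₂ : c₂ * y = e * y - l * (ρ * (κ + x) - x))
    (hd : d * y = c₂ * y + m * (ρ * (κ + x) + x)) :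
    CollapsedTent x y h a₁ a₂ q₁ q₂ e c₁ c₂ d := by
  have H6 := H.orient₆_pos
  obtain ⟨hx, hx2, hy, hκ, hκ1, hκ2, hσ, hσ1, hρ, hρ1, hl, hm, hm1, rρ, rl, rm, lt1, lt2⟩ := H
  have eq_c : 2 * (c₁ * x + c₂ * y) = h ^ 2 - (x ^ 2 + y ^ 2) := by
    subst hc₁; linear_combination 2 * hc₂ + 2 * he - hh2 - 2 * rl
  have eq_q : 2 * (a₁ * q₁ + a₂ * q₂) + q₁ ^ 2 + q₂ ^ 2 = 0 := by
    subst hq₁ hq₂ ha₁; linear_combination 2 * ρ * ha₂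
  have eq_qe : q₁ / 2 + q₂ * e = a₁ * x + a₂ * y + x - 1 / 2 - a₁ := by
    subst hq₁ hq₂ ha₁; linear_combination ρ * he - ha₂ + rρ / 2
  have eq_qc : q₁ * c₁ + q₂ * c₂ = a₁ * x + a₂ * y := by
    subst hq₁ hq₂ ha₁ hc₁; linear_combination eq_qe + ρ * hc₂ - rl
  have eq_d : 2 * (-(q₁ + x) / 2 + d * (q₂ + y)) - 2 * (a₁ * x + a₂ * y) + x ^ 2 + y ^ 2 =
      h ^ 2 := by
    subst hq₁ hq₂ ha₁
    linear_combination 2 * (1 + ρ) * hd + 2 * (1 + ρ) * hc₂ + 2 * he + 2 * eq_qe - hh2 +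
      2 * (ρ * (κ + x) + x) * rm - 4 * rl
  have eT : -(e + d) / 2 * y = (x ^ 2 + y ^ 2 - 2 * x - ρ * κ * (m - l)) / 2 := by
    linear_combination -he - hd / 2 - hc₂ / 2 - x / 2 * rm
  have e21 : (c₁ * e - c₂ / 2) * y =
      l * ((x ^ 2 + y ^ 2 - 2 * x) * (1 - ρ) + ρ * κ) / 2 := by
    subst hc₁; linear_combination -hc₂ / 2 - l * (1 - ρ) * he
  have e32 : (-c₂ / 2 - d * c₁) * y =
      m * (2 * σ + (x ^ 2 + y ^ 2 - 2 * x) * (1 + ρ) / 2 - ρ * κ / 2) := by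
    subst hc₁
    linear_combination -(1 / 2 - l * (1 - ρ)) * hd + c₂ * y * rm - m * (1 + ρ) * hc₂ -
      m * (1 + ρ) * he + 2 * m * rl
  have e01 : ((a₁ + q₁) * e - (a₂ + q₂) / 2) * y =
      ((1 / 2 - x + σ) * (x ^ 2 + y ^ 2 - 2 * x - κ) -
        ρ * ((κ + x) * (x ^ 2 + y ^ 2 - x) + (y ^ 2 - (κ + x) ^ 2) / 2)) / 2 := by
    subst hq₁ hq₂ ha₁
    linear_combination (x - 1 / 2 - σ + ρ * (κ + x)) * he - ha₂ / 2
  have e12 : ((a₁ + q₁) * (c₂ - e) - (a₂ + q₂) * (c₁ - 1 / 2)) * y =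
      l * (κ * (1 / 2 - x + σ - ρ * (κ + x)) + ρ * (1 - ρ) * ((κ + x) ^ 2 + y ^ 2) / 2) := by
    subst hq₁ hq₂ ha₁ hc₁
    linear_combination (x - 1 / 2 - σ + ρ * (κ + x)) * hc₂ + l * (1 - ρ) * ha₂
  have e23 : ((a₁ + q₁) * (d - c₂) + (a₂ + q₂) * (c₁ + 1 / 2)) * y =
      m * (κ * (1 / 2 - x + σ - ρ * (κ + x)) + ρ * (1 + ρ) * ((κ + x) ^ 2 + y ^ 2) / 2) := by
    have hc₁' : c₁ = m * (1 + ρ) - 1 / 2 := by linear_combination hc₁ - rm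
    subst hq₁ hq₂ ha₁ hc₁'
    linear_combination (x - 1 / 2 - σ + ρ * (κ + x)) * hd + m * (1 + ρ) * ha₂
  have e0 : ((c₁ + 1 / 2) * (d + y - a₂) - (c₂ - d) * (x - 1 / 2 - a₁)) * y =
      m * ((ρ * (κ + x) + x) ^ 2 + (1 + ρ) ^ 2 * y ^ 2 + h ^ 2) / 2 := by
    have hc₁' : c₁ = m * (1 + ρ) - 1 / 2 := by linear_combination hc₁ - rm
    have h1 : (1 + ρ) * y * (d + y - a₂) = ((ρ * (κ + x) + x) ^ 2 + (1 + ρ) ^ 2 * y ^ 2 +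
        h ^ 2) / 2 - σ * (ρ * (κ + x) + x) := by
      subst hq₁ hq₂ ha₁
      linear_combination eq_d / 2 - eq_q / 2
    subst ha₁ hc₁'
    linear_combination m * h1 + σ * hd
  have e4 : (d + y - a₂ + (e - d) * (x - 1 / 2 - a₁)) * ((1 + ρ) * y) =
      ((ρ * (κ + x) + x - 2 * σ) ^ 2 + (1 + ρ) ^ 2 * y ^ 2 + h ^ 2) / 2 := by
    have h1 : ρ * (κ + x) + x + (e - d) * (1 + ρ) * y = 2 * σ := by
      linear_combination 2 * rl - (ρ * (κ + x) + x) * rm - (1 + ρ) * (hd + hc₂)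
    subst hq₁ hq₂ ha₁
    linear_combination eq_d / 2 - eq_q / 2 + σ * h1
  -- The multiplier equals `ρ * κ * y`, which is positive, and it turns the area into a sum of
  -- squares.
  have e5 : ((c₁ + x) * a₂ - (c₂ + y) * a₁) * (q₁ * y - q₂ * x) =
      ((2 * (a₁ * x + a₂ * y) + (q₁ * x + q₂ * y)) ^ 2 + h ^ 2 * (q₁ ^ 2 + q₂ ^ 2) +
        (q₁ * y - q₂ * x) ^ 2) / 4 := by
    linear_combination (a₁ * x + a₂ * y) * eq_qc - (a₁ * q₁ + a₂ * q₂) / 2 * eq_c -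
      (h ^ 2 + (x ^ 2 + y ^ 2)) / 4 * eq_q
  have e6 : ((a₁ + 1) * (e + y) - a₂ * (x - 1 / 2)) * y =
      ((1 / 2 + x - σ) * (x - x ^ 2 + y ^ 2) + (1 - 2 * x) * ((1 / 2 - x + σ) * (κ + x) -
        ρ * ((κ + x) ^ 2 + y ^ 2) / 2)) / 2 := by
    subst ha₁
    linear_combination (1 / 2 + x - σ) * he - (x - 1 / 2) * ha₂
  have e7 : ((1 / 2 - c₁) * (c₂ + y + a₂) - (e - c₂) * (c₁ + x + a₁)) * y =
      l * ((ρ * (κ + x) - x) ^ 2 + (1 - ρ) ^ 2 * y ^ 2 + h ^ 2) / 2 := by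
    have h1 : (1 - ρ) * y * (c₂ + y + a₂) - (ρ * (κ + x) - x) * (c₁ + x + a₁) =
        ((ρ * (κ + x) - x) ^ 2 + (1 - ρ) ^ 2 * y ^ 2 + h ^ 2) / 2 := by
      subst hq₁ hq₂
      linear_combination eq_c / 2 - eq_q / 2 - eq_qc
    have hc₁' : 1 / 2 - c₁ = l * (1 - ρ) := by linear_combination -hc₁
    linear_combination l * h1 + (c₂ + y + a₂) * y * hc₁' + (c₁ + x + a₁) * hc₂
  have hN : 0 < x ^ 2 + y ^ 2 - 2 * x := by linarith
  have hρκ : ρ * κ < κ / 8 := by linarith [mul_lt_mul_of_pos_right hρ1 hκ]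
  have hw : 0 < κ * (1 / 2 - x + σ - ρ * (κ + x)) := mul_pos hκ (by linarith)
  have hρ' : 0 < 1 - ρ := by linarith
  have hqb : 0 < q₁ * y - q₂ * x := by
    have : q₁ * y - q₂ * x = ρ * κ * y := by subst hq₁ hq₂; ring
    rw [this]; positivity
  have pos : ∀ {s t : ℝ}, s * y = t → 0 < t → 0 < s := fun e ht =>
    (mul_pos_iff_of_pos_right hy).1 (e ▸ ht)
  refine ⟨hy, hh, by linarith, eq_c, by linarith, eq_q, eq_qc, eq_qe, eq_d, hqb, ?_, ?_, ?_, ?_, ?_,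
    ?_, ?_, ?_, ?_, ?_, ?_, ?_, ?_, ?_, ?_⟩
  · rw [hq₂]; positivity
  · have : 0 < -(e + d) / 2 := by
      refine pos eT ?_
      have h1 : ρ * κ * m ≤ ρ * κ * 1 := mul_le_mul_of_nonneg_left hm1.le (by positivity)
      have h2 : 0 < ρ * κ * l := by positivity
      linarith
    linarith
  · exact pos e21 (by positivity)
  · refine pos e32 (mul_pos hm ?_)
    linarith [mul_pos hρ hN]
  · rw [← sub_pos]
    refine pos (t := m * ((1 + ρ) * (x ^ 2 + y ^ 2 - 2 * x) - ρ * κ) / 2) ?_ ?_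
    · linear_combination eT - e21 - (x ^ 2 + y ^ 2 - 2 * x) / 2 * rm
    · exact half_pos (mul_pos hm (by linarith [mul_pos hρ hN]))
  · rw [← sub_pos]
    refine pos (t := 2 * m * σ) ?_ (by positivity)
    linear_combination e21 + e32 - eT + (x ^ 2 + y ^ 2 - 2 * x) / 2 * rm
  · rw [← sub_pos]
    refine pos (t := l * ((x ^ 2 + y ^ 2 - 2 * x) * (1 - ρ) + ρ * κ * (1 - 2 * m))) ?_
      (mul_pos hl ?_)
    · linear_combination eT - e32 + e21 - (x ^ 2 + y ^ 2 - 2 * x) / 2 * rm + 2 * m * rl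
    · have h1 : ρ * κ * m ≤ ρ * κ * 1 := mul_le_mul_of_nonneg_left hm1.le (by positivity)
      have h2 := mul_lt_mul_of_pos_left hρ1 hN
      linarith
  · exact pos e01 (half_pos (by linarith))
  · rw [← sub_pos]
    refine pos ((congrArg (· * y) ?_).trans e12) ?_
    · ring
    · positivity
  · rw [← sub_pos]
    refine pos ((congrArg (· * y) ?_).trans e23) ?_
    · ring
    · positivity
  · exact pos e0 (by positivity)
  · exact (mul_pos_iff_of_pos_right (by positivity : 0 < (1 + ρ) * y)).1 (e4 ▸ (by positivity))
  · exact (mul_pos_iff_of_pos_right hqb).1 (e5 ▸ (by positivity))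
  · exact pos e6 (half_pos H6)
  · exact pos e7 (by positivity)

/-! ### Symmetric configurations and their developments

The parameters are `θ = (x, y, a₁, a₂, w₀, w₁, w₂, w₃)`: the half periods are `1` and `x + y * I`,
    the
point `A = a₁ + a₂ * I` locates the vertex `0` in the development, and `wⱼ` is the height of the
vertex `j`. The unknowns are `Y = (B, C, D, p₀, p₁, p₃)`: the points `B`, `C`, `D` locate the
    vertices
`1`, `2`, `3` in the development, and `p₀`, `p₁`, `C`, `p₃` are the horizontal coordinates of the
vertices `0`, `1`, `2`, `3`. -/

/-- The symmetric configuration with given parameters. -/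
def tent (θ : Fin 8 → ℝ) (Y : Fin 12 → ℝ) : Config :=
  (![!₂[Y 6, Y 7, θ 4], !₂[Y 8, Y 9, θ 5], !₂[Y 2, Y 3, θ 6], !₂[Y 10, Y 11, θ 7],
    !₂[-Y 10, -Y 11, θ 7], !₂[-Y 2, -Y 3, θ 6], !₂[-Y 8, -Y 9, θ 5], !₂[-Y 6, -Y 7, θ 4]] :
    Fin 8 → E3)

lemma forall_zmod_eight {p : ZMod 8 → Prop} :
    (∀ j, p j) ↔ p 0 ∧ p 1 ∧ p 2 ∧ p 3 ∧ p 4 ∧ p 5 ∧ p 6 ∧ p 7 := by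
  refine ⟨fun h => ⟨h 0, h 1, h 2, h 3, h 4, h 5, h 6, h 7⟩, ?_⟩
  rintro ⟨h0, h1, h2, h3, h4, h5, h6, h7⟩ j
  fin_cases j <;> assumption

section
variable (θ : Fin 8 → ℝ) (Y : Fin 12 → ℝ)

lemma tent_zero : tent θ Y 0 = !₂[Y 6, Y 7, θ 4] := rfl
lemma tent_one : tent θ Y 1 = !₂[Y 8, Y 9, θ 5] := rfl
lemma tent_two : tent θ Y 2 = !₂[Y 2, Y 3, θ 6] := rfl
lemma tent_three : tent θ Y 3 = !₂[Y 10, Y 11, θ 7] := rfl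
lemma tent_four : tent θ Y 4 = !₂[-Y 10, -Y 11, θ 7] := rfl
lemma tent_five : tent θ Y 5 = !₂[-Y 2, -Y 3, θ 6] := rfl
lemma tent_six : tent θ Y 6 = !₂[-Y 8, -Y 9, θ 5] := rfl
lemma tent_seven : tent θ Y 7 = !₂[-Y 6, -Y 7, θ 4] := rfl

lemma tent_symm : ∀ j, tent θ Y (7 - j) = rho (tent θ Y j) := by
  rw [forall_zmod_eight]
  refine ⟨?_, ?_, ?_, ?_, ?_, ?_, ?_, ?_⟩ <;> (ext i; fin_cases i) <;>
    first
    | rfl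
    | exact (neg_neg _).symm

/-- The deviation of the development of the vertex `j` from a linear map. -/
def deviation : ZMod 8 → ℂ :=
  -- The labels `0, …, 7` are lifted to `(0,0), (0,1), (1,0), (1,1), (2,0), (2,1), (3,0), (3,1)`.
  -- Labels `j` and `7 - j` are placed at opposite points, so the symmetry develops to `z ↦ -z`.
  -- Subtracting the linear part leaves a function of the label alone.
  (![⟨θ 2 - θ 0, θ 3 - θ 1⟩,
    ⟨Y 0 - 1 - θ 0 - (-3 + θ 0) / 4, Y 1 - θ 1 - θ 1 / 4⟩,
    ⟨Y 2 - (2 + 2 * θ 0) / 4, Y 3 - 2 * θ 1 / 4⟩,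
    ⟨Y 4 - 1 - (-1 + 3 * θ 0) / 4, Y 5 - 3 * θ 1 / 4⟩,
    ⟨-(Y 4 - 1) - (4 + 4 * θ 0) / 4, -Y 5 - 4 * θ 1 / 4⟩,
    ⟨-Y 2 - (1 + 5 * θ 0) / 4, -Y 3 - 5 * θ 1 / 4⟩,
    ⟨-(Y 0 - 1 - θ 0) - (6 + 6 * θ 0) / 4, -(Y 1 - θ 1) - 6 * θ 1 / 4⟩,
    ⟨-(θ 2 - θ 0) - (3 + 7 * θ 0) / 4, -(θ 3 - θ 1) - 7 * θ 1 / 4⟩] : Fin 8 → ℂ)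

/-- The linear map `ℤ × ℤ → ℂ` that maps the basis `(1, -2)`, `(3, 2)` of the deck group to the
periods. -/
def linearPart (v : ℤ × ℤ) : ℂ :=
  ⟨((2 * v.1 - 3 * v.2 : ℤ) + (2 * v.1 + v.2 : ℤ) * θ 0) / 4, (2 * v.1 + v.2 : ℤ) * θ 1 / 4⟩

/-- The development of a symmetric configuration. -/
def develop (v : ℤ × ℤ) : ℂ := linearPart θ v + deviation θ Y (label v)

/-- The developed edge that leads from a vertex with label `j` in the direction `e`. -/
def edge (e : ℤ × ℤ) (j : ZMod 8) : ℂ :=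
  linearPart θ e + deviation θ Y (j + label e) - deviation θ Y j

lemma linearPart_add (v w : ℤ × ℤ) :
    linearPart θ (v + w) = linearPart θ v + linearPart θ w := by
  apply Complex.ext <;> simp [linearPart] <;> ring

lemma develop_add_sub (v e : ℤ × ℤ) :
    develop θ Y (v + e) - develop θ Y v = edge θ Y e (label v) := by
  rw [develop, develop, edge, linearPart_add, label_add]
  ring

/-- Twice the signed area of the developed lower triangle at a vertex with label `j`. -/
def lowerArea (j : ZMod 8) : ℝ :=
  (edge θ Y (1, 0) j).re * (edge θ Y (1, 1) j).im - (edge θ Y (1, 0) j).im * (edge θ Y (1, 1) j).re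

/-- The deviations of a symmetric configuration from an isometric one. -/
def edgeDefect (z : (Fin 8 → ℝ) × (Fin 12 → ℝ)) : Fin 12 → ℝ :=
  ![2 * (z.2 0 * z.1 0 + z.2 1 * z.1 1) - (z.1 0 ^ 2 + z.1 1 ^ 2 - (z.1 5 - z.1 7) ^ 2),
    2 * (z.2 2 * z.1 0 + z.2 3 * z.1 1) - ((z.1 4 - z.1 6) ^ 2 - (z.1 0 ^ 2 + z.1 1 ^ 2)),
    2 * z.2 4 - (1 - (z.1 6 - z.1 7) ^ 2),
    z.2 6 ^ 2 + z.2 7 ^ 2 - (z.1 2 ^ 2 + z.1 3 ^ 2),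
    z.2 8 ^ 2 + z.2 9 ^ 2 - (z.2 0 ^ 2 + z.2 1 ^ 2),
    z.2 10 ^ 2 + z.2 11 ^ 2 - (z.2 4 ^ 2 + z.2 5 ^ 2),
    z.2 6 * z.2 2 + z.2 7 * z.2 3 - ((z.2 2 + z.1 0) * z.1 2 + (z.2 3 + z.1 1) * z.1 3),
    z.2 6 * z.2 8 + z.2 7 * z.2 9 - ((z.1 2 + 1) * z.2 0 + z.1 3 * z.2 1),
    z.2 8 * z.2 10 + z.2 9 * z.2 11 - ((z.2 0 - z.1 0) * z.2 4 + (z.2 1 - z.1 1) * z.2 5),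
    z.2 2 * z.2 10 + z.2 3 * z.2 11 - ((z.2 4 - 1) * z.2 2 + z.2 5 * z.2 3),
    (z.2 4 - z.1 2 + z.1 0 - 1) ^ 2 + (z.2 5 - z.1 3 + z.1 1) ^ 2 -
      ((z.2 6 - z.2 10) ^ 2 + (z.2 7 - z.2 11) ^ 2) - (z.1 4 - z.1 7) ^ 2,
    (z.2 2 - z.2 0 + z.1 0 - 1) ^ 2 + (z.2 3 - z.2 1 + z.1 1) ^ 2 -
      ((z.2 8 - z.2 2) ^ 2 + (z.2 9 - z.2 3) ^ 2) - (z.1 5 - z.1 6) ^ 2]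

end

/-! ### Developed edge vectors, their lengths and the triangle areas. -/

lemma norm_eq_dist {z : ℂ} {p q : E3}
    (h : z.re ^ 2 + z.im ^ 2 = (p 0 - q 0) ^ 2 + (p 1 - q 1) ^ 2 + (p 2 - q 2) ^ 2) :
    ‖z‖ = dist p q := by
  rw [EuclideanSpace.dist_eq, Fin.sum_univ_three, Complex.norm_eq_sqrt_sq_add_sq, h]
  simp only [Real.dist_eq, sq_abs]

variable {θ : Fin 8 → ℝ} {Y : Fin 12 → ℝ}

lemma edge_right_zero : edge θ Y (1, 0) 0 = ⟨-θ 2 + Y 2 + θ 0, -θ 3 + Y 3 + θ 1⟩ := by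
  rw [show edge θ Y (1, 0) 0 = linearPart θ (1, 0) + deviation θ Y 2 - deviation θ Y 0 from rfl]
  apply Complex.ext <;> simp [linearPart, deviation] <;> ring

lemma edge_right_one : edge θ Y (1, 0) 1 = ⟨-Y 0 + Y 4 + θ 0, -Y 1 + Y 5 + θ 1⟩ := by
  rw [show edge θ Y (1, 0) 1 = linearPart θ (1, 0) + deviation θ Y 3 - deviation θ Y 1 from rfl]
  apply Complex.ext <;> simp [linearPart, deviation] <;> ring

lemma edge_right_two : edge θ Y (1, 0) 2 = ⟨-Y 2 - Y 4 + 1, -Y 3 - Y 5⟩ := by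
  rw [show edge θ Y (1, 0) 2 = linearPart θ (1, 0) + deviation θ Y 4 - deviation θ Y 2 from rfl]
  apply Complex.ext <;> simp [linearPart, deviation] <;> ring

lemma edge_right_three : edge θ Y (1, 0) 3 = ⟨-Y 2 - Y 4 + 1, -Y 3 - Y 5⟩ := by
  rw [show edge θ Y (1, 0) 3 = linearPart θ (1, 0) + deviation θ Y 5 - deviation θ Y 3 from rfl]
  apply Complex.ext <;> simp [linearPart, deviation] <;> ring

lemma edge_right_four : edge θ Y (1, 0) 4 = ⟨-Y 0 + Y 4 + θ 0, -Y 1 + Y 5 + θ 1⟩ := by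
  rw [show edge θ Y (1, 0) 4 = linearPart θ (1, 0) + deviation θ Y 6 - deviation θ Y 4 from rfl]
  apply Complex.ext <;> simp [linearPart, deviation] <;> ring

lemma edge_right_five : edge θ Y (1, 0) 5 = ⟨-θ 2 + Y 2 + θ 0, -θ 3 + Y 3 + θ 1⟩ := by
  rw [show edge θ Y (1, 0) 5 = linearPart θ (1, 0) + deviation θ Y 7 - deviation θ Y 5 from rfl]
  apply Complex.ext <;> simp [linearPart, deviation] <;> ring

lemma edge_right_six : edge θ Y (1, 0) 6 = ⟨θ 2 + Y 0 + 1, θ 3 + Y 1⟩ := by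
  rw [show edge θ Y (1, 0) 6 = linearPart θ (1, 0) + deviation θ Y 0 - deviation θ Y 6 from rfl]
  apply Complex.ext <;> simp [linearPart, deviation] <;> ring

lemma edge_right_seven : edge θ Y (1, 0) 7 = ⟨θ 2 + Y 0 + 1, θ 3 + Y 1⟩ := by
  rw [show edge θ Y (1, 0) 7 = linearPart θ (1, 0) + deviation θ Y 1 - deviation θ Y 7 from rfl]
  apply Complex.ext <;> simp [linearPart, deviation] <;> ring

lemma edge_up_zero : edge θ Y (0, 1) 0 = ⟨-θ 2 + Y 0 - 1, -θ 3 + Y 1⟩ := by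
  rw [show edge θ Y (0, 1) 0 = linearPart θ (0, 1) + deviation θ Y 1 - deviation θ Y 0 from rfl]
  apply Complex.ext <;> simp [linearPart, deviation] <;> ring

lemma edge_up_one : edge θ Y (0, 1) 1 = ⟨-Y 0 + Y 2 + θ 0 - 1, -Y 1 + Y 3 + θ 1⟩ := by
  rw [show edge θ Y (0, 1) 1 = linearPart θ (0, 1) + deviation θ Y 2 - deviation θ Y 1 from rfl]
  apply Complex.ext <;> simp [linearPart, deviation] <;> ring

lemma edge_up_two : edge θ Y (0, 1) 2 = ⟨-Y 2 + Y 4 - 1, -Y 3 + Y 5⟩ := by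
  rw [show edge θ Y (0, 1) 2 = linearPart θ (0, 1) + deviation θ Y 3 - deviation θ Y 2 from rfl]
  apply Complex.ext <;> simp [linearPart, deviation] <;> ring

lemma edge_up_three : edge θ Y (0, 1) 3 = ⟨-2 * Y 4, -2 * Y 5⟩ := by
  rw [show edge θ Y (0, 1) 3 = linearPart θ (0, 1) + deviation θ Y 4 - deviation θ Y 3 from rfl]
  apply Complex.ext <;> simp [linearPart, deviation] <;> ring

lemma edge_up_four : edge θ Y (0, 1) 4 = ⟨-Y 2 + Y 4 - 1, -Y 3 + Y 5⟩ := by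
  rw [show edge θ Y (0, 1) 4 = linearPart θ (0, 1) + deviation θ Y 5 - deviation θ Y 4 from rfl]
  apply Complex.ext <;> simp [linearPart, deviation] <;> ring

lemma edge_up_five : edge θ Y (0, 1) 5 = ⟨-Y 0 + Y 2 + θ 0 - 1, -Y 1 + Y 3 + θ 1⟩ := by
  rw [show edge θ Y (0, 1) 5 = linearPart θ (0, 1) + deviation θ Y 6 - deviation θ Y 5 from rfl]
  apply Complex.ext <;> simp [linearPart, deviation] <;> ring

lemma edge_up_six : edge θ Y (0, 1) 6 = ⟨-θ 2 + Y 0 - 1, -θ 3 + Y 1⟩ := by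
  rw [show edge θ Y (0, 1) 6 = linearPart θ (0, 1) + deviation θ Y 7 - deviation θ Y 6 from rfl]
  apply Complex.ext <;> simp [linearPart, deviation] <;> ring

lemma edge_up_seven : edge θ Y (0, 1) 7 = ⟨2 * θ 2, 2 * θ 3⟩ := by
  rw [show edge θ Y (0, 1) 7 = linearPart θ (0, 1) + deviation θ Y 0 - deviation θ Y 7 from rfl]
  apply Complex.ext <;> simp [linearPart, deviation] <;> ring

lemma edge_diagonal_zero : edge θ Y (1, 1) 0 = ⟨-θ 2 + Y 4 + θ 0 - 1, -θ 3 + Y 5 + θ 1⟩ := by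
  rw [show edge θ Y (1, 1) 0 = linearPart θ (1, 1) + deviation θ Y 3 - deviation θ Y 0 from rfl]
  apply Complex.ext <;> simp [linearPart, deviation] <;> ring

lemma edge_diagonal_one : edge θ Y (1, 1) 1 = ⟨-Y 0 - Y 4 + θ 0, -Y 1 - Y 5 + θ 1⟩ := by
  rw [show edge θ Y (1, 1) 1 = linearPart θ (1, 1) + deviation θ Y 4 - deviation θ Y 1 from rfl]
  apply Complex.ext <;> simp [linearPart, deviation] <;> ring

lemma edge_diagonal_two : edge θ Y (1, 1) 2 = ⟨-2 * Y 2, -2 * Y 3⟩ := by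
  rw [show edge θ Y (1, 1) 2 = linearPart θ (1, 1) + deviation θ Y 5 - deviation θ Y 2 from rfl]
  apply Complex.ext <;> simp [linearPart, deviation] <;> ring

lemma edge_diagonal_three : edge θ Y (1, 1) 3 = ⟨-Y 0 - Y 4 + θ 0, -Y 1 - Y 5 + θ 1⟩ := by
  rw [show edge θ Y (1, 1) 3 = linearPart θ (1, 1) + deviation θ Y 6 - deviation θ Y 3 from rfl]
  apply Complex.ext <;> simp [linearPart, deviation] <;> ring

lemma edge_diagonal_four : edge θ Y (1, 1) 4 = ⟨-θ 2 + Y 4 + θ 0 - 1, -θ 3 + Y 5 + θ 1⟩ := by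
  rw [show edge θ Y (1, 1) 4 = linearPart θ (1, 1) + deviation θ Y 7 - deviation θ Y 4 from rfl]
  apply Complex.ext <;> simp [linearPart, deviation] <;> ring

lemma edge_diagonal_five : edge θ Y (1, 1) 5 = ⟨θ 2 + Y 2 + θ 0, θ 3 + Y 3 + θ 1⟩ := by
  rw [show edge θ Y (1, 1) 5 = linearPart θ (1, 1) + deviation θ Y 0 - deviation θ Y 5 from rfl]
  apply Complex.ext <;> simp [linearPart, deviation] <;> ring

lemma edge_diagonal_six : edge θ Y (1, 1) 6 = ⟨2 * Y 0, 2 * Y 1⟩ := by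
  rw [show edge θ Y (1, 1) 6 = linearPart θ (1, 1) + deviation θ Y 1 - deviation θ Y 6 from rfl]
  apply Complex.ext <;> simp [linearPart, deviation] <;> ring

lemma edge_diagonal_seven : edge θ Y (1, 1) 7 = ⟨θ 2 + Y 2 + θ 0, θ 3 + Y 3 + θ 1⟩ := by
  rw [show edge θ Y (1, 1) 7 = linearPart θ (1, 1) + deviation θ Y 2 - deviation θ Y 7 from rfl]
  apply Complex.ext <;> simp [linearPart, deviation] <;> ring

/-- The 24 edges form 14 orbits under the symmetry. The edge `{2, 5}` is matched automatically
because `C` serves both as developed and as horizontal position, and one further condition is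
absorbed into `hA`. The twelve components of `edgeDefect` encode the rest, combined so that the
conditions for pairs such as `P j, P k` and `P j, ρ (P k)` separate into norms and inner products.
-/
lemma norm_edge_right (hA : 2 * θ 2 = (θ 4 - θ 5) ^ 2 - 1) (hF : edgeDefect (θ, Y) = 0) :
    ∀ j, ‖edge θ Y (1, 0) j‖ = dist (tent θ Y j) (tent θ Y (j + 2)) := by
  have f := fun i => congrFun hF i
  have f0 := f 0; have f1 := f 1; have f2 := f 2; have f3 := f 3; have f4 := f 4; have f5 := f 5
  have f6 := f 6; have f7 := f 7; have f8 := f 8; have f9 := f 9; have f10 := f 10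
  have f11 := f 11
  simp [edgeDefect] at f0 f1 f2 f3 f4 f5 f6 f7 f8 f9 f10 f11
  rw [forall_zmod_eight]
  refine ⟨norm_eq_dist ?_, norm_eq_dist ?_, norm_eq_dist ?_, norm_eq_dist ?_, norm_eq_dist ?_,
    norm_eq_dist ?_, norm_eq_dist ?_, norm_eq_dist ?_⟩
  · rw [show (0 : ZMod 8) + 2 = 2 from rfl, tent_zero, tent_two, edge_right_zero]
    simp
    linear_combination -f3 + f1 + 2 * f6
  · rw [show (1 : ZMod 8) + 2 = 3 from rfl, tent_one, tent_three, edge_right_one]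
    simp
    linear_combination -f5 - f4 - f0 + 2 * f8
  · rw [show (2 : ZMod 8) + 2 = 4 from rfl, tent_two, tent_four, edge_right_two]
    simp
    linear_combination -f5 - f2 - 2 * f9
  · rw [show (3 : ZMod 8) + 2 = 5 from rfl, tent_three, tent_five, edge_right_three]
    simp
    linear_combination -f5 - f2 - 2 * f9
  · rw [show (4 : ZMod 8) + 2 = 6 from rfl, tent_four, tent_six, edge_right_four]
    simp
    linear_combination -f5 - f4 - f0 + 2 * f8
  · rw [show (5 : ZMod 8) + 2 = 7 from rfl, tent_five, tent_seven, edge_right_five]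
    simp
    linear_combination -f3 + f1 + 2 * f6
  · rw [show (6 : ZMod 8) + 2 = 0 from rfl, tent_six, tent_zero, edge_right_six]
    simp
    linear_combination -f3 - f4 + hA - 2 * f7
  · rw [show (7 : ZMod 8) + 2 = 1 from rfl, tent_seven, tent_one, edge_right_seven]
    simp
    linear_combination -f3 - f4 + hA - 2 * f7

lemma norm_edge_up (hA : 2 * θ 2 = (θ 4 - θ 5) ^ 2 - 1) (hF : edgeDefect (θ, Y) = 0) :
    ∀ j, ‖edge θ Y (0, 1) j‖ = dist (tent θ Y j) (tent θ Y (j + 1)) := by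
  have f := fun i => congrFun hF i
  have f0 := f 0; have f1 := f 1; have f2 := f 2; have f3 := f 3; have f4 := f 4; have f5 := f 5
  have f6 := f 6; have f7 := f 7; have f8 := f 8; have f9 := f 9; have f10 := f 10
  have f11 := f 11
  simp [edgeDefect] at f0 f1 f2 f3 f4 f5 f6 f7 f8 f9 f10 f11
  rw [forall_zmod_eight]
  refine ⟨norm_eq_dist ?_, norm_eq_dist ?_, norm_eq_dist ?_, norm_eq_dist ?_, norm_eq_dist ?_,
    norm_eq_dist ?_, norm_eq_dist ?_, norm_eq_dist ?_⟩
  · rw [show (0 : ZMod 8) + 1 = 1 from rfl, tent_zero, tent_one, edge_up_zero]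
    simp
    linear_combination -f3 - f4 + hA + 2 * f7
  · rw [show (1 : ZMod 8) + 1 = 2 from rfl, tent_one, tent_two, edge_up_one]
    simp
    linear_combination f11
  · rw [show (2 : ZMod 8) + 1 = 3 from rfl, tent_two, tent_three, edge_up_two]
    simp
    linear_combination -f5 - f2 + 2 * f9
  · rw [show (3 : ZMod 8) + 1 = 4 from rfl, tent_three, tent_four, edge_up_three]
    simp
    linear_combination -4 * f5
  · rw [show (4 : ZMod 8) + 1 = 5 from rfl, tent_four, tent_five, edge_up_four]
    simp
    linear_combination -f5 - f2 + 2 * f9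
  · rw [show (5 : ZMod 8) + 1 = 6 from rfl, tent_five, tent_six, edge_up_five]
    simp
    linear_combination f11
  · rw [show (6 : ZMod 8) + 1 = 7 from rfl, tent_six, tent_seven, edge_up_six]
    simp
    linear_combination -f3 - f4 + hA + 2 * f7
  · rw [show (7 : ZMod 8) + 1 = 0 from rfl, tent_seven, tent_zero, edge_up_seven]
    simp
    linear_combination -4 * f3

lemma norm_edge_diagonal (hF : edgeDefect (θ, Y) = 0) :
    ∀ j, ‖edge θ Y (1, 1) j‖ = dist (tent θ Y j) (tent θ Y (j + 3)) := by
  have f := fun i => congrFun hF i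
  have f0 := f 0; have f1 := f 1; have f2 := f 2; have f3 := f 3; have f4 := f 4; have f5 := f 5
  have f6 := f 6; have f7 := f 7; have f8 := f 8; have f9 := f 9; have f10 := f 10
  have f11 := f 11
  simp [edgeDefect] at f0 f1 f2 f3 f4 f5 f6 f7 f8 f9 f10 f11
  rw [forall_zmod_eight]
  refine ⟨norm_eq_dist ?_, norm_eq_dist ?_, norm_eq_dist ?_, norm_eq_dist ?_, norm_eq_dist ?_,
    norm_eq_dist ?_, norm_eq_dist ?_, norm_eq_dist ?_⟩
  · rw [show (0 : ZMod 8) + 3 = 3 from rfl, tent_zero, tent_three, edge_diagonal_zero]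
    simp
    linear_combination f10
  · rw [show (1 : ZMod 8) + 3 = 4 from rfl, tent_one, tent_four, edge_diagonal_one]
    simp
    linear_combination -f5 - f4 - f0 - 2 * f8
  · rw [show (2 : ZMod 8) + 3 = 5 from rfl, tent_two, tent_five, edge_diagonal_two]
    simp
    ring
  · rw [show (3 : ZMod 8) + 3 = 6 from rfl, tent_three, tent_six, edge_diagonal_three]
    simp
    linear_combination -f5 - f4 - f0 - 2 * f8
  · rw [show (4 : ZMod 8) + 3 = 7 from rfl, tent_four, tent_seven, edge_diagonal_four]
    simp
    linear_combination f10
  · rw [show (5 : ZMod 8) + 3 = 0 from rfl, tent_five, tent_zero, edge_diagonal_five]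
    simp
    linear_combination -f3 + f1 - 2 * f6
  · rw [show (6 : ZMod 8) + 3 = 1 from rfl, tent_six, tent_one, edge_diagonal_six]
    simp
    linear_combination -4 * f4
  · rw [show (7 : ZMod 8) + 3 = 2 from rfl, tent_seven, tent_two, edge_diagonal_seven]
    simp
    linear_combination -f3 + f1 - 2 * f6

/-- The point reflection induced by `j ↦ 7 - j` carries the upper triangle `j, j+3, j+1` to the
lower triangle based at `4 - j`. -/
lemma upperArea_eq : ∀ j, (edge θ Y (1, 1) j).re * (edge θ Y (0, 1) j).im -
    (edge θ Y (1, 1) j).im * (edge θ Y (0, 1) j).re = lowerArea θ Y (4 - j) := by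
  rw [forall_zmod_eight]
  refine ⟨?_, ?_, ?_, ?_, ?_, ?_, ?_, ?_⟩
  · rw [show (4 : ZMod 8) - 0 = 4 from rfl, lowerArea, edge_right_four, edge_diagonal_four,
      edge_up_zero, edge_diagonal_zero]
    simp only
    ring
  · rw [show (4 : ZMod 8) - 1 = 3 from rfl, lowerArea, edge_right_three, edge_diagonal_three,
      edge_up_one, edge_diagonal_one]
    simp only
    ring
  · rw [show (4 : ZMod 8) - 2 = 2 from rfl, lowerArea, edge_right_two, edge_diagonal_two,
      edge_up_two]
    simp only
    ring
  · rw [show (4 : ZMod 8) - 3 = 1 from rfl, lowerArea, edge_right_one, edge_diagonal_one,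
      edge_up_three, edge_diagonal_three]
    simp only
    ring
  · rw [show (4 : ZMod 8) - 4 = 0 from rfl, lowerArea, edge_right_zero, edge_diagonal_zero,
      edge_up_four, edge_diagonal_four]
    simp only
    ring
  · rw [show (4 : ZMod 8) - 5 = 7 from rfl, lowerArea, edge_right_seven, edge_diagonal_seven,
      edge_up_five, edge_diagonal_five]
    simp only
    ring
  · rw [show (4 : ZMod 8) - 6 = 6 from rfl, lowerArea, edge_right_six, edge_diagonal_six,
      edge_up_six]
    simp only
    ring
  · rw [show (4 : ZMod 8) - 7 = 5 from rfl, lowerArea, edge_right_five, edge_diagonal_five,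
      edge_up_seven, edge_diagonal_seven]
    simp only
    ring

lemma label_right : label (1, 0) = 2 := rfl
lemma label_up : label (0, 1) = 1 := rfl
lemma label_diagonal : label (1, 1) = 3 := rfl

lemma linearPart_one_neg_two : linearPart θ (1, -2) = 2 := by
  apply Complex.ext <;> (simp [linearPart]; try norm_num)

lemma linearPart_three_two : linearPart θ (3, 2) = 2 * ⟨θ 0, θ 1⟩ := by
  apply Complex.ext <;> simp [linearPart] <;> ring

lemma isDevelopment_develop (hA : 2 * θ 2 = (θ 4 - θ 5) ^ 2 - 1) (hF : edgeDefect (θ, Y) = 0)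
    (ho : ∀ j, 0 < lowerArea θ Y j) :
    IsDevelopment (tent θ Y) (develop θ Y) 2 (2 * ⟨θ 0, θ 1⟩) where
  isometric v e he := by
    rw [dist_comm, dist_eq_norm, develop_add_sub, label_add]
    simp only [Set.mem_insert_iff, Set.mem_singleton_iff] at he
    rcases he with rfl | rfl | rfl
    · rw [norm_edge_right hA hF, label_right]
    · rw [norm_edge_up hA hF, label_up]
    · rw [norm_edge_diagonal hF, label_diagonal]
  oriented_lower v := by
    have := ho (label v)
    rw [PositivelyOriented, develop_add_sub, develop_add_sub]
    simp only [Complex.mul_im, Complex.conj_re, Complex.conj_im]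
    unfold lowerArea at this
    linarith
  oriented_upper v := by
    have := ho (4 - label v)
    rw [← upperArea_eq] at this
    rw [PositivelyOriented, develop_add_sub, develop_add_sub]
    simp only [Complex.mul_im, Complex.conj_re, Complex.conj_im]
    linarith
  translation₁ v := by
    rw [develop, linearPart_add, label_add, show label (1, -2) = 0 from rfl, add_zero,
      linearPart_one_neg_two, develop]
    ring
  translation₂ v := by
    rw [develop, linearPart_add, label_add, show label (3, 2) = 0 from rfl, add_zero,
      linearPart_three_two, develop]
    ring

/-! ### The collapsed configuration -/

/-- The unknowns of the collapsed configuration. -/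
def collapsedUnknowns (x y a₁ a₂ q₁ q₂ e c₁ c₂ d : ℝ) : Fin 12 → ℝ :=
  ![x - 1 / 2, e + y, c₁, c₂, 1 / 2, d, a₁ + q₁, a₂ + q₂, 1 / 2, e, -1 / 2, d]

/-- The parameters of the configurations near the collapsed one: `s` is the height of the vertices
`1, …, 6`. -/
def tentParameters (x y h a₁ a₂ a s : ℝ) : Fin 8 → ℝ :=
  ![x, y, a₁, a₂, -h, 0, s * (2 + a), s * 2]

namespace CollapsedTent

variable {x y h a₁ a₂ q₁ q₂ e c₁ c₂ d : ℝ}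

lemma edgeDefect_eq_zero (H : CollapsedTent x y h a₁ a₂ q₁ q₂ e c₁ c₂ d) (a : ℝ) :
    edgeDefect (tentParameters x y h a₁ a₂ a 0, collapsedUnknowns x y a₁ a₂ q₁ q₂ e c₁ c₂ d) =
      0 := by
  obtain ⟨hy, hh, eq_a, eq_c, eq_e, eq_q, eq_qc, eq_qe, eq_d, -, -, -, -, -, -, -, -, -, -, -, -,
      -, -, -, -⟩ := H
  funext i
  fin_cases i <;> simp [edgeDefect, tentParameters, collapsedUnknowns]
  · linear_combination eq_e
  · linear_combination eq_c
  · linear_combination eq_q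
  · linear_combination -eq_e
  · ring
  · linear_combination eq_qc
  · linear_combination eq_qe
  · ring
  · ring
  · linear_combination eq_d - eq_q
  · ring

lemma lowerArea_pos (H : CollapsedTent x y h a₁ a₂ q₁ q₂ e c₁ c₂ d) (a : ℝ) :
    ∀ j, 0 < lowerArea (tentParameters x y h a₁ a₂ a 0)
      (collapsedUnknowns x y a₁ a₂ q₁ q₂ e c₁ c₂ d) j := by
  obtain ⟨hy, hh, -, -, -, -, -, -, -, hqb, hq, hT, h21, h32, hlt, hTlt, hsub, h01, h12, h23, o0,
      o4, o5, o6, o7⟩ := H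
  rw [forall_zmod_eight]
  refine ⟨?_, ?_, ?_, ?_, ?_, ?_, ?_, ?_⟩
  · rw [lowerArea, edge_right_zero, edge_diagonal_zero]
    simp [tentParameters, collapsedUnknowns]
    linarith
  · rw [lowerArea, edge_right_one, edge_diagonal_one]
    simp [tentParameters, collapsedUnknowns]
    linarith
  · rw [lowerArea, edge_right_two, edge_diagonal_two]
    simp [collapsedUnknowns]
    linarith
  · rw [lowerArea, edge_right_three, edge_diagonal_three]
    simp [tentParameters, collapsedUnknowns]
    linarith
  · rw [lowerArea, edge_right_four, edge_diagonal_four]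
    simp [tentParameters, collapsedUnknowns]
    linarith
  · rw [lowerArea, edge_right_five, edge_diagonal_five]
    simp [tentParameters, collapsedUnknowns]
    linarith
  · rw [lowerArea, edge_right_six, edge_diagonal_six]
    simp [tentParameters, collapsedUnknowns]
    linarith
  · rw [lowerArea, edge_right_seven, edge_diagonal_seven]
    simp [tentParameters, collapsedUnknowns]
    linarith

end CollapsedTent

/-! ### The order type near the collapsed configuration -/

lemma vol_apex (a₁ a₂ h b₁ b₂ c₁ c₂ d₁ d₂ : ℝ) :
    vol !₂[a₁, a₂, -h] !₂[b₁, b₂, 0] !₂[c₁, c₂, 0] !₂[d₁, d₂, 0] =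
      h * ((c₁ - b₁) * (d₂ - b₂) - (c₂ - b₂) * (d₁ - b₁)) := by
  simp [vol]
  ring

lemma vol_apex_apex (a₁ a₂ h b₁ b₂ c₁ c₂ : ℝ) :
    vol !₂[a₁, a₂, -h] !₂[b₁, b₂, 0] !₂[c₁, c₂, 0] !₂[-a₁, -a₂, -h] =
      2 * h * (a₁ * (c₂ - b₂) - a₂ * (c₁ - b₁)) := by
  simp [vol]
  ring

/-- The heights of the vertices `1, …, 6` are all proportional to `s`, so `s` scales the vertical
direction. Dividing it out leaves a quantity with a nondegenerate limit as `s → 0`. -/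
lemma vol_tent_eq_mul (x y h a₁ a₂ a s : ℝ) (Y : Fin 12 → ℝ) : ∀ q ∈ innerQuads,
    vol (tent (tentParameters x y h a₁ a₂ a s) Y q.1)
      (tent (tentParameters x y h a₁ a₂ a s) Y q.2.1)
      (tent (tentParameters x y h a₁ a₂ a s) Y q.2.2.1)
      (tent (tentParameters x y h a₁ a₂ a s) Y q.2.2.2) =
    s * vol (tent (tentParameters x y h a₁ a₂ a 1) Y q.1)
      (tent (tentParameters x y h a₁ a₂ a 1) Y q.2.1)
      (tent (tentParameters x y h a₁ a₂ a 1) Y q.2.2.1)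
      (tent (tentParameters x y h a₁ a₂ a 1) Y q.2.2.2) := by
  simp only [innerQuads, List.forall_mem_cons, List.not_mem_nil, false_imp_iff, implies_true,
      and_true,
    tent_one, tent_two, tent_three, tent_four, tent_five, tent_six]
  refine ⟨?_, ?_, ?_, ?_, ?_, ?_, ?_, ?_, ?_⟩ <;> (simp [vol, tentParameters]; ring)

namespace CollapsedTent

variable {x y h a₁ a₂ q₁ q₂ e c₁ c₂ d : ℝ}

/-- The hypothesis on `a` says that it is the coefficient of `p₁` when `p₂` is expanded in the
horizontal positions `p₁, p₃`. With this ratio of infinitesimal heights all nine volumes follow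
linearly from the planar inequalities and their products with `a`. -/
lemma vol_inner_pos (H : CollapsedTent x y h a₁ a₂ q₁ q₂ e c₁ c₂ d) {a : ℝ}
    (ha : a * (-(e + d) / 2) = -c₂ / 2 - d * c₁) : ∀ q ∈ innerQuads,
    0 < vol (tent (tentParameters x y h a₁ a₂ a 1) (collapsedUnknowns x y a₁ a₂ q₁ q₂ e c₁ c₂ d)
        q.1)
      (tent (tentParameters x y h a₁ a₂ a 1) (collapsedUnknowns x y a₁ a₂ q₁ q₂ e c₁ c₂ d) q.2.1)
      (tent (tentParameters x y h a₁ a₂ a 1) (collapsedUnknowns x y a₁ a₂ q₁ q₂ e c₁ c₂ d) q.2.2.1)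
      (tent (tentParameters x y h a₁ a₂ a 1) (collapsedUnknowns x y a₁ a₂ q₁ q₂ e c₁ c₂ d)
        q.2.2.2) := by
  obtain ⟨-, -, -, -, -, -, -, -, -, -, -, hT, h21, h32, hlt, hTlt, hsub, -, -, -, -, -, -, -, -⟩
      := H
  have ha0 : 0 < a := (mul_pos_iff_of_pos_right (by linarith : 0 < -(e + d) / 2)).1 (ha ▸ h32)
  have k1 := mul_pos ha0 h21
  have k2 := mul_pos ha0 h32
  have k3 := mul_pos ha0 (sub_pos.2 hlt)
  have k4 := mul_pos ha0 (sub_pos.2 hTlt)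
  have k5 := mul_pos ha0 (sub_pos.2 hsub)
  simp only [innerQuads, List.forall_mem_cons, List.not_mem_nil, false_imp_iff, implies_true,
      and_true,
    tent_one, tent_two, tent_three, tent_four, tent_five, tent_six]
  refine ⟨?_, ?_, ?_, ?_, ?_, ?_, ?_, ?_, ?_⟩ <;>
    (simp [vol, tentParameters, collapsedUnknowns]; linarith)

/-- With the vertices `1, …, 6` in one plane, each volume is `h` or `2 * h` times a planar cross
product, so only planar orientations matter. -/
lemma vol_outer_pos (H : CollapsedTent x y h a₁ a₂ q₁ q₂ e c₁ c₂ d) (a : ℝ) : ∀ q ∈ outerQuads,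
    0 < vol (tent (tentParameters x y h a₁ a₂ a 0) (collapsedUnknowns x y a₁ a₂ q₁ q₂ e c₁ c₂ d)
        q.1)
      (tent (tentParameters x y h a₁ a₂ a 0) (collapsedUnknowns x y a₁ a₂ q₁ q₂ e c₁ c₂ d) q.2.1)
      (tent (tentParameters x y h a₁ a₂ a 0) (collapsedUnknowns x y a₁ a₂ q₁ q₂ e c₁ c₂ d) q.2.2.1)
      (tent (tentParameters x y h a₁ a₂ a 0) (collapsedUnknowns x y a₁ a₂ q₁ q₂ e c₁ c₂ d)
        q.2.2.2) := by
  obtain ⟨-, hh, -, -, -, -, -, -, -, -, -, hT, h21, h32, hlt, hTlt, hsub, h01, h12, h23, -, -, -,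
      -, -⟩ := H
  have e0 : tent (tentParameters x y h a₁ a₂ a 0) (collapsedUnknowns x y a₁ a₂ q₁ q₂ e c₁ c₂ d) 0 =
      !₂[a₁ + q₁, a₂ + q₂, -h] := rfl
  have e1 : tent (tentParameters x y h a₁ a₂ a 0) (collapsedUnknowns x y a₁ a₂ q₁ q₂ e c₁ c₂ d) 1 =
      !₂[1 / 2, e, 0] := rfl
  have e2 : tent (tentParameters x y h a₁ a₂ a 0) (collapsedUnknowns x y a₁ a₂ q₁ q₂ e c₁ c₂ d) 2 =
      !₂[c₁, c₂, 0] := by simp [tent_two, tentParameters, collapsedUnknowns]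
  have e3 : tent (tentParameters x y h a₁ a₂ a 0) (collapsedUnknowns x y a₁ a₂ q₁ q₂ e c₁ c₂ d) 3 =
      !₂[-1 / 2, d, 0] := by simp [tent_three, tentParameters, collapsedUnknowns]
  have e4 : tent (tentParameters x y h a₁ a₂ a 0) (collapsedUnknowns x y a₁ a₂ q₁ q₂ e c₁ c₂ d) 4 =
      !₂[1 / 2, -d, 0] := by simp [tent_four, tentParameters, collapsedUnknowns]; norm_num
  have e5 : tent (tentParameters x y h a₁ a₂ a 0) (collapsedUnknowns x y a₁ a₂ q₁ q₂ e c₁ c₂ d) 5 =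
      !₂[-c₁, -c₂, 0] := by simp [tent_five, tentParameters, collapsedUnknowns]
  have e6 : tent (tentParameters x y h a₁ a₂ a 0) (collapsedUnknowns x y a₁ a₂ q₁ q₂ e c₁ c₂ d) 6 =
      !₂[-1 / 2, -e, 0] := by simp [tent_six, tentParameters, collapsedUnknowns]; norm_num
  have e7 : tent (tentParameters x y h a₁ a₂ a 0) (collapsedUnknowns x y a₁ a₂ q₁ q₂ e c₁ c₂ d) 7 =
      !₂[-(a₁ + q₁), -(a₂ + q₂), -h] := rfl
  have hh2 : 0 < 2 * h := by positivity
  simp only [outerQuads, List.forall_mem_cons, List.not_mem_nil, false_imp_iff, implies_true,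
      and_true,
    e0, e1, e2, e3, e4, e5, e6, e7, vol_apex, vol_apex_apex]
  refine ⟨?_, ?_, ?_, ?_, ?_, ?_, ?_, ?_, ?_, ?_, ?_, ?_, ?_, ?_, ?_, ?_, ?_, ?_, ?_, ?_, ?_, ?_,
      ?_,
    ?_, ?_, ?_, ?_, ?_, ?_⟩ <;>
    first
    | exact mul_pos hh (by linarith)
    | exact mul_pos hh2 (by linarith)

end CollapsedTent

/-! ### Nondegeneracy of the edge equations -/

/-- The derivative of the edge equations in the direction of the unknowns. -/
def edgeDerivative (θ : Fin 8 → ℝ) (Y v : Fin 12 → ℝ) : Fin 12 → ℝ :=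
  fun i => (edgeDefect (θ, Y + v) i - edgeDefect (θ, Y - v) i) / 2

/-- The equations have degree at most two in the unknowns, so the symmetric difference quotient with
step one is the exact derivative. -/
lemma hasDerivAt_edgeDefect (θ : Fin 8 → ℝ) (Y v : Fin 12 → ℝ) :
    HasDerivAt (fun t : ℝ => edgeDefect (θ, Y + t • v)) (edgeDerivative θ Y v) 0 := by
  rw [hasDerivAt_pi]
  intro i
  have key : ∀ t : ℝ, edgeDefect (θ, Y + t • v) i = edgeDefect (θ, Y) i +
      t * edgeDerivative θ Y v i + t ^ 2 * ((edgeDefect (θ, Y + v) i + edgeDefect (θ, Y - v) i) / 2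
          -
        edgeDefect (θ, Y) i) := by
    intro t
    fin_cases i <;> (simp [edgeDerivative, edgeDefect]; ring)
  simp only [key]
  have h1 := ((hasDerivAt_id (0 : ℝ)).mul_const (edgeDerivative θ Y v i)).const_add
    (edgeDefect (θ, Y) i)
  have h2 := ((hasDerivAt_id (0 : ℝ)).pow 2).mul_const
    ((edgeDefect (θ, Y + v) i + edgeDefect (θ, Y - v) i) / 2 - edgeDefect (θ, Y) i)
  exact (h1.add h2).congr_deriv (by simp)

lemma eq_zero_of_cross {u₁ u₂ v₁ v₂ r₁ r₂ : ℝ} (h : u₁ * v₂ - u₂ * v₁ ≠ 0)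
    (hu : u₁ * r₁ + u₂ * r₂ = 0) (hv : v₁ * r₁ + v₂ * r₂ = 0) : r₁ = 0 ∧ r₂ = 0 := by
  constructor
  · have : (u₁ * v₂ - u₂ * v₁) * r₁ = 0 := by linear_combination v₂ * hu - u₂ * hv
    exact (mul_eq_zero.1 this).resolve_left h
  · have : (u₁ * v₂ - u₂ * v₁) * r₂ = 0 := by linear_combination u₁ * hv - v₁ * hu
    exact (mul_eq_zero.1 this).resolve_left h

/-- The linearized equations are triangular in blocks: apart from the single unknowns `v 4` at the
start and `v 5` at the end, each stage is a planar vector orthogonal to two independent vectors. The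
determinants are nonzero by the strict inequalities of a collapsed tent. -/
lemma CollapsedTent.eq_zero_of_edgeDerivative {x y h a₁ a₂ q₁ q₂ e c₁ c₂ d : ℝ}
    (H : CollapsedTent x y h a₁ a₂ q₁ q₂ e c₁ c₂ d) (a : ℝ) {v : Fin 12 → ℝ}
    (hv : edgeDerivative (tentParameters x y h a₁ a₂ a 0)
      (collapsedUnknowns x y a₁ a₂ q₁ q₂ e c₁ c₂ d) v = 0) : v = 0 := by
  obtain ⟨hy, hh, -, -, -, -, -, -, -, hqb, hq, hT, h21, h32, hlt, hTlt, hsub, h01, -, -, -, -, -,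
      -, -⟩ := H
  have f := fun i => congrFun hv i
  have f0 := f 0; have f1 := f 1; have f2 := f 2; have f3 := f 3; have f4 := f 4; have f5 := f 5
  have f6 := f 6; have f7 := f 7; have f8 := f 8; have f9 := f 9; have f10 := f 10
  have f11 := f 11
  simp [edgeDerivative, edgeDefect, tentParameters,
    collapsedUnknowns] at f0 f1 f2 f3 f4 f5 f6 f7 f8 f9 f10 f11
  have d1 : v 4 = 0 := by linarith only [f2]
  obtain ⟨g10, g11⟩ := eq_zero_of_cross (u₁ := c₁) (u₂ := c₂) (v₁ := -1 / 2) (v₂ := d)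
    (r₁ := v 10 - v 4) (r₂ := v 11 - v 5) (by intro h0; linarith only [h0, h32])
    (by linarith only [f9]) (by linarith only [f5, d1])
  have d10 : v 10 = 0 := by linarith only [g10, d1]
  have d11 : v 11 = v 5 := by linarith only [g11]
  rw [d1, d10, d11] at f8 f10
  obtain ⟨g8, g9⟩ := eq_zero_of_cross (u₁ := 1 / 2 - c₁) (u₂ := e - c₂) (v₁ := c₁ - 1 / 2)
    (v₂ := c₂ + d) (r₁ := v 8 - v 0) (r₂ := v 9 - v 1) (by intro h0; linarith only [h0, hsub])
    (by linarith only [f11]) (by linarith only [f11, f4, f8, f0])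
  have d8 : v 8 = v 0 := by linarith only [g8]
  have d9 : v 9 = v 1 := by linarith only [g9]
  rw [d8, d9] at f4 f7
  obtain ⟨d0, d1'⟩ := eq_zero_of_cross (u₁ := 1) (u₂ := 0) (v₁ := x) (v₂ := y) (r₁ := v 0)
    (r₂ := v 1) (by intro h0; linarith only [h0, hy]) (by linarith only [f0, f4])
    (by linarith only [f0])
  rw [d0, d1'] at f7
  obtain ⟨d6, d7⟩ := eq_zero_of_cross (u₁ := a₁ + q₁) (u₂ := a₂ + q₂) (v₁ := 1 / 2) (v₂ := e)
    (r₁ := v 6) (r₂ := v 7) (by intro h0; linarith only [h0, h01]) (by linarith only [f3])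
    (by linarith only [f7])
  rw [d6, d7] at f6 f10
  obtain ⟨d2, d3⟩ := eq_zero_of_cross (u₁ := q₁) (u₂ := q₂) (v₁ := x) (v₂ := y)
    (r₁ := v 2) (r₂ := v 3) (by intro h0; linarith only [h0, hqb]) (by linarith only [f6])
    (by linarith only [f1])
  have d5 : v 5 = 0 := by
    have : (q₂ + y) * v 5 = 0 := by linarith only [f10]
    exact (mul_eq_zero.1 this).resolve_left hq.ne'
  funext i
  fin_cases i
  · exact d0
  · exact d1'
  · exact d2
  · exact d3
  · exact d1
  · exact d5
  · exact d6
  · exact d7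
  · exact d8.trans d0
  · exact d9.trans d1'
  · exact d10
  · exact d11.trans d5

open Filter Topology

/-! ### Continuity -/

lemma contDiff_edgeDefect : ContDiff ℝ 1 edgeDefect := by
  rw [contDiff_pi]
  intro i
  fin_cases i <;> simp only [edgeDefect] <;> simp <;> fun_prop

lemma continuous_tent (j : ZMod 8) :
    Continuous fun u : (Fin 8 → ℝ) × (Fin 12 → ℝ) => tent u.1 u.2 j := by
  revert j
  rw [forall_zmod_eight]
  simp only [tent_zero, tent_one, tent_two, tent_three, tent_four, tent_five, tent_six, tent_seven]
  refine ⟨?_, ?_, ?_, ?_, ?_, ?_, ?_, ?_⟩ <;>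
    refine (PiLp.continuous_toLp 2 _).comp (continuous_pi fun i => ?_) <;>
    fin_cases i <;> simp <;> fun_prop

lemma continuous_lowerArea (j : ZMod 8) :
    Continuous fun u : (Fin 8 → ℝ) × (Fin 12 → ℝ) => lowerArea u.1 u.2 j := by
  revert j
  rw [forall_zmod_eight]
  simp only [lowerArea, edge_right_zero, edge_right_one, edge_right_two, edge_right_three,
    edge_right_four, edge_right_five, edge_right_six, edge_right_seven, edge_diagonal_zero,
    edge_diagonal_one, edge_diagonal_two, edge_diagonal_three, edge_diagonal_four,
    edge_diagonal_five, edge_diagonal_six, edge_diagonal_seven]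
  refine ⟨?_, ?_, ?_, ?_, ?_, ?_, ?_, ?_⟩ <;> fun_prop

lemma continuous_vol_tent (a b c d : ZMod 8) : Continuous fun u : (Fin 8 → ℝ) × (Fin 12 → ℝ) =>
    vol (tent u.1 u.2 a) (tent u.1 u.2 b) (tent u.1 u.2 c) (tent u.1 u.2 d) := by
  have h : ∀ (j : ZMod 8) (i : Fin 3),
      Continuous fun u : (Fin 8 → ℝ) × (Fin 12 → ℝ) => tent u.1 u.2 j i := fun j i =>
    (EuclideanSpace.proj i : E3 →L[ℝ] ℝ).continuous.comp (continuous_tent j)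
  have hs : ∀ (j k : ZMod 8) (i : Fin 3), Continuous fun u : (Fin 8 → ℝ) × (Fin 12 → ℝ) =>
      tent u.1 u.2 k i - tent u.1 u.2 j i := fun j k i => (h k i).sub (h j i)
  exact (((hs a b 0).mul (((hs a c 1).mul (hs a d 2)).sub ((hs a c 2).mul (hs a d 1)))).sub
    ((hs a b 1).mul (((hs a c 0).mul (hs a d 2)).sub ((hs a c 2).mul (hs a d 0))))).add
    ((hs a b 2).mul (((hs a c 0).mul (hs a d 1)).sub ((hs a c 1).mul (hs a d 0))))

/-! ### The family of collapsed tents -/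

/-- The height of the collapsed tent. -/
def baseHeight (b : ℝ × ℝ) : ℝ := √(2 * b.1 - 2 * sig b.1 b.2)

/-- The first coordinate of the point `A` of the collapsed tent. -/
def baseA₁ (b : ℝ × ℝ) : ℝ := b.1 - 1 / 2 - sig b.1 b.2

/-- The second coordinate of the point `A` of the collapsed tent. -/
def baseA₂ (b : ℝ × ℝ) : ℝ :=
  ((1 / 2 - b.1 + sig b.1 b.2) * (kap b.1 b.2 + b.1) -
    rat b.1 b.2 * ((kap b.1 b.2 + b.1) ^ 2 + b.2 ^ 2) / 2) / b.2

/-- The second coordinate of the vertex `1` of the collapsed tent. -/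
def baseE (b : ℝ × ℝ) : ℝ := (b.1 - (b.1 ^ 2 + b.2 ^ 2)) / 2 / b.2

/-- The first coordinate of the vertex `2` of the collapsed tent. -/
def baseC₁ (b : ℝ × ℝ) : ℝ := 1 / 2 - len b.1 b.2 * (1 - rat b.1 b.2)

/-- The second coordinate of the vertex `2` of the collapsed tent. -/
def baseC₂ (b : ℝ × ℝ) : ℝ :=
  baseE b - len b.1 b.2 * (rat b.1 b.2 * (kap b.1 b.2 + b.1) - b.1) / b.2

/-- The second coordinate of the vertex `3` of the collapsed tent. -/
def baseD (b : ℝ × ℝ) : ℝ :=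
  baseC₂ b + len' b.1 b.2 * (rat b.1 b.2 * (kap b.1 b.2 + b.1) + b.1) / b.2

/-- The ratio that determines the infinitesimal heights. -/
def baseRatio (b : ℝ × ℝ) : ℝ :=
  (-baseC₂ b / 2 - baseD b * baseC₁ b) / (-(baseE b + baseD b) / 2)

/-- The parameters of the tents near the collapsed ones. -/
def baseParameters (t : (ℝ × ℝ) × ℝ) : Fin 8 → ℝ :=
  tentParameters t.1.1 t.1.2 (baseHeight t.1) (baseA₁ t.1) (baseA₂ t.1) (baseRatio t.1) t.2

/-- The unknowns of the collapsed tents. -/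
def baseUnknowns (b : ℝ × ℝ) : Fin 12 → ℝ :=
  collapsedUnknowns b.1 b.2 (baseA₁ b) (baseA₂ b) (rat b.1 b.2 * (kap b.1 b.2 + b.1))
    (rat b.1 b.2 * b.2) (baseE b) (baseC₁ b) (baseC₂ b) (baseD b)

lemma collapsedTent_base {b : ℝ × ℝ} (hb : b ∈ periodDomain) :
    CollapsedTent b.1 b.2 (baseHeight b) (baseA₁ b) (baseA₂ b)
      (rat b.1 b.2 * (kap b.1 b.2 + b.1)) (rat b.1 b.2 * b.2) (baseE b) (baseC₁ b) (baseC₂ b)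
      (baseD b) := by
  have H := collapseParameters (x := b.1) (y := b.2) hb
  have hy : b.2 ≠ 0 := H.y_pos.ne'
  have h0 : 0 < 2 * b.1 - 2 * sig b.1 b.2 := by linarith [H.σ_lt, H.x_pos]
  refine H.collapsedTent (Real.sqrt_pos.2 h0) (Real.sq_sqrt h0.le) rfl rfl rfl ?_ ?_ rfl ?_ ?_
  · exact div_mul_cancel₀ _ hy
  · exact div_mul_cancel₀ _ hy
  · rw [baseC₂, sub_mul, div_mul_cancel₀ _ hy]
  · rw [baseD, add_mul, div_mul_cancel₀ _ hy]

lemma baseRatio_mul {b : ℝ × ℝ} (hb : b ∈ periodDomain) :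
    baseRatio b * (-(baseE b + baseD b) / 2) = -baseC₂ b / 2 - baseD b * baseC₁ b :=
  div_mul_cancel₀ _ (by have := (collapsedTent_base hb).cross_T; linarith)

lemma isOpen_periodDomain : IsOpen periodDomain := by
  simp only [periodDomain, Set.ofPred_and]
  exact (isOpen_lt (by fun_prop) (by fun_prop)).inter ((isOpen_lt (by fun_prop) (by fun_prop)).inter
    ((isOpen_lt (by fun_prop) (by fun_prop)).inter (isOpen_lt (by fun_prop) (by fun_prop))))

lemma continuousAt_base {b : ℝ × ℝ} (hb : b ∈ periodDomain) :
    ContinuousAt baseHeight b ∧ ContinuousAt baseA₁ b ∧ ContinuousAt baseA₂ b ∧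
    ContinuousAt baseRatio b ∧ ContinuousAt baseUnknowns b := by
  have H := collapseParameters (x := b.1) (y := b.2) hb
  have hx := H.x_pos; have hy := H.y_pos; have hκ := H.κ_pos; have hρ := H.ρ_pos
  have h1 : ContinuousAt (fun b : ℝ × ℝ => b.1) b := continuousAt_fst
  have h2 : ContinuousAt (fun b : ℝ × ℝ => b.2) b := continuousAt_snd
  have cκ : ContinuousAt (fun b : ℝ × ℝ => kap b.1 b.2) b := by
    unfold kap
    exact ContinuousAt.div (by fun_prop) (by fun_prop)
      (mul_pos (by norm_num) (add_pos (pow_pos hx 2) (pow_pos hy 2))).ne'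
  have cσ : ContinuousAt (fun b : ℝ × ℝ => sig b.1 b.2) b :=
    ((continuousAt_const.sub (continuousAt_const.mul h1)).mul (cκ.pow 2)).div_const 8
  have cρ : ContinuousAt (fun b : ℝ × ℝ => rat b.1 b.2) b :=
    ((continuousAt_const.mul cσ).add (((continuousAt_const.sub (continuousAt_const.mul h1)).mul
      cκ).div (continuousAt_const.add cκ) (add_pos one_pos hκ).ne')).div
      (cκ.add (continuousAt_const.mul h1)) (add_pos hκ (mul_pos two_pos hx)).ne'
  have cl : ContinuousAt (fun b : ℝ × ℝ => len b.1 b.2) b :=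
    cσ.div (cρ.mul cκ) (mul_pos hρ hκ).ne'
  have cm : ContinuousAt (fun b : ℝ × ℝ => len' b.1 b.2) b :=
    (continuousAt_const.sub (cl.mul (continuousAt_const.sub cρ))).div (continuousAt_const.add cρ)
      (add_pos one_pos hρ).ne'
  have cq : ContinuousAt (fun b : ℝ × ℝ => rat b.1 b.2 * (kap b.1 b.2 + b.1)) b :=
    cρ.mul (cκ.add h1)
  have ch : ContinuousAt baseHeight b :=
    ((continuousAt_const.mul h1).sub (continuousAt_const.mul cσ)).sqrt
  have ca₁ : ContinuousAt baseA₁ b := (h1.sub continuousAt_const).sub cσ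
  have ca₂ : ContinuousAt baseA₂ b :=
    ((((continuousAt_const.sub h1).add cσ).mul (cκ.add h1)).sub
      ((cρ.mul (((cκ.add h1).pow 2).add (h2.pow 2))).div_const 2)).div h2 hy.ne'
  have ce : ContinuousAt baseE b :=
    ((h1.sub ((h1.pow 2).add (h2.pow 2))).div_const 2).div h2 hy.ne'
  have cc₁ : ContinuousAt baseC₁ b := continuousAt_const.sub (cl.mul (continuousAt_const.sub cρ))
  have cc₂ : ContinuousAt baseC₂ b := ce.sub ((cl.mul (cq.sub h1)).div h2 hy.ne')
  have cd : ContinuousAt baseD b := cc₂.add ((cm.mul (cq.add h1)).div h2 hy.ne')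
  have cr : ContinuousAt baseRatio b :=
    ((cc₂.neg.div_const 2).sub (cd.mul cc₁)).div ((ce.add cd).neg.div_const 2)
      (by have := (collapsedTent_base hb).cross_T; linarith)
  refine ⟨ch, ca₁, ca₂, cr, continuousAt_pi.2 fun i => ?_⟩
  fin_cases i
  · exact h1.sub continuousAt_const
  · exact ce.add h2
  · exact cc₁
  · exact cc₂
  · exact continuousAt_const
  · exact cd
  · exact ca₁.add cq
  · exact ca₂.add (cρ.mul h2)
  · exact continuousAt_const
  · exact ce
  · exact continuousAt_const
  · exact cd

lemma continuousAt_baseParameters {t : (ℝ × ℝ) × ℝ} (ht : t.1 ∈ periodDomain) :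
    ContinuousAt baseParameters t := by
  obtain ⟨ch, ca₁, ca₂, cr, -⟩ := continuousAt_base ht
  have c1 : ContinuousAt (fun t : (ℝ × ℝ) × ℝ => t.1) t := continuousAt_fst
  have c2 : ContinuousAt (fun t : (ℝ × ℝ) × ℝ => t.2) t := continuousAt_snd
  refine continuousAt_pi.2 fun i => ?_
  fin_cases i
  · exact continuousAt_fst.comp c1
  · exact continuousAt_snd.comp c1
  · exact ca₁.comp c1
  · exact ca₂.comp c1
  · exact (ch.comp c1).neg
  · exact continuousAt_const
  · exact c2.mul (continuousAt_const.add (cr.comp c1))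
  · exact c2.mul continuousAt_const

/-! ### The implicit function theorem -/

lemma isInvertible_fderiv_edgeDefect {θ : Fin 8 → ℝ} {Y : Fin 12 → ℝ}
    (h : ∀ v, edgeDerivative θ Y v = 0 → v = 0) :
    (fderiv ℝ edgeDefect (θ, Y) ∘L .inr ℝ (Fin 8 → ℝ) (Fin 12 → ℝ)).IsInvertible := by
  have key : ∀ v, (fderiv ℝ edgeDefect (θ, Y) ∘L .inr ℝ (Fin 8 → ℝ) (Fin 12 → ℝ)) v =
      edgeDerivative θ Y v := fun v => by
    have h1 : HasFDerivAt edgeDefect (fderiv ℝ edgeDefect (θ, Y)) (θ, Y + (0 : ℝ) • v) := by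
      rw [zero_smul, add_zero]
      exact (contDiff_edgeDefect.differentiable one_ne_zero).differentiableAt.hasFDerivAt
    have h2 : HasDerivAt (fun t : ℝ => (θ, Y + t • v)) ((0 : Fin 8 → ℝ), v) 0 := by
      refine (hasDerivAt_const _ _).prodMk ?_
      simpa using ((hasDerivAt_id (0 : ℝ)).smul_const v).const_add Y
    have h3 := HasFDerivAt.comp_hasDerivAt (0 : ℝ) h1 h2
    exact h3.unique (hasDerivAt_edgeDefect θ Y v)
  have hinj : Function.Injective
      (fderiv ℝ edgeDefect (θ, Y) ∘L .inr ℝ (Fin 8 → ℝ) (Fin 12 → ℝ)).toLinearMap := by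
    rw [injective_iff_map_eq_zero]
    intro v hv
    exact h v ((key v).symm.trans hv)
  exact ⟨(LinearEquiv.ofInjectiveEndo _ hinj).toContinuousLinearEquiv, rfl⟩

/-- A point of the family: parameters and unknowns satisfying the edge equations and the open
conditions that yield pup tents. -/
structure IsAdmissible (z : ((ℝ × ℝ) × ℝ) × (Fin 12 → ℝ)) : Prop where
  mem : z.1.1 ∈ periodDomain
  edge : edgeDefect (baseParameters z.1, z.2) = 0
  lower : ∀ j, 0 < lowerArea (baseParameters z.1) z.2 j
  outer : ∀ q ∈ outerQuads, 0 < vol (tent (baseParameters z.1) z.2 q.1)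
    (tent (baseParameters z.1) z.2 q.2.1) (tent (baseParameters z.1) z.2 q.2.2.1)
    (tent (baseParameters z.1) z.2 q.2.2.2)
  inner : ∀ q ∈ innerQuads, 0 < vol (tent (baseParameters (z.1.1, 1)) z.2 q.1)
    (tent (baseParameters (z.1.1, 1)) z.2 q.2.1) (tent (baseParameters (z.1.1, 1)) z.2 q.2.2.1)
    (tent (baseParameters (z.1.1, 1)) z.2 q.2.2.2)

/-- The implicit function theorem applies at `s = 0`, and the remaining conditions are open and hold
there. The inner volumes are tested at height scale `1`, with `s` divided out, so they too are open
at the collapsed tent. The last clause, local uniqueness, serves to glue sections. -/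
lemma exists_section {b : ℝ × ℝ} (hb : b ∈ periodDomain) :
    ∃ r > 0, ∃ φ : (ℝ × ℝ) × ℝ → (Fin 12 → ℝ), φ (b, 0) = baseUnknowns b ∧
      (∀ t ∈ Metric.ball (b, (0 : ℝ)) r, ContinuousAt φ t ∧ IsAdmissible (t, φ t)) ∧
      ∀ᶠ z in 𝓝 ((b, (0 : ℝ)), baseUnknowns b), edgeDefect (baseParameters z.1, z.2) = 0 →
        φ z.1 = z.2 := by
  have H := collapsedTent_base hb
  have cdf : ContDiffAt ℝ 1 edgeDefect (baseParameters (b, 0), baseUnknowns b) :=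
    contDiff_edgeDefect.contDiffAt
  have inv := isInvertible_fderiv_edgeDefect fun v hv =>
    H.eq_zero_of_edgeDerivative (baseRatio b) hv
  change (fderiv ℝ edgeDefect (baseParameters (b, 0), baseUnknowns b) ∘L
    .inr ℝ (Fin 8 → ℝ) (Fin 12 → ℝ)).IsInvertible at inv
  have h0 : edgeDefect (baseParameters (b, 0), baseUnknowns b) = 0 := H.edgeDefect_eq_zero _
  set ψ := cdf.implicitFunction one_ne_zero inv with hψ
  have ψ0 : ψ (baseParameters (b, 0)) = baseUnknowns b :=
    cdf.implicitFunction_apply_self one_ne_zero inv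
  have cψ : ∀ᶠ θ in 𝓝 (baseParameters (b, 0)), ContinuousAt ψ θ :=
    ((cdf.contDiffAt_implicitFunction one_ne_zero inv).eventually (by simp)).mono
      fun θ hθ => hθ.continuousAt
  have eψ : ∀ᶠ θ in 𝓝 (baseParameters (b, 0)), edgeDefect (θ, ψ θ) = 0 :=
    (cdf.eventually_apply_implicitFunction one_ne_zero inv).mono fun θ hθ => hθ.trans h0
  have cP : ContinuousAt baseParameters (b, 0) := continuousAt_baseParameters hb
  have cφ : ContinuousAt (ψ ∘ baseParameters) (b, 0) := ContinuousAt.comp cψ.self_of_nhds cP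
  have cPφ : ContinuousAt (fun t => (baseParameters t, ψ (baseParameters t))) (b, 0) :=
    cP.prodMk cφ
  have cP1 : ContinuousAt (fun t : (ℝ × ℝ) × ℝ => (baseParameters (t.1, 1),
      ψ (baseParameters t))) (b, 0) := by
    refine ContinuousAt.prodMk ?_ cφ
    have : ContinuousAt baseParameters ((fun t : (ℝ × ℝ) × ℝ => (t.1, (1 : ℝ))) (b, 0)) :=
      continuousAt_baseParameters hb
    exact ContinuousAt.comp (f := fun t : (ℝ × ℝ) × ℝ => (t.1, (1 : ℝ))) this (by fun_prop)
  have ev : ∀ᶠ t in 𝓝 (b, (0 : ℝ)), ContinuousAt (ψ ∘ baseParameters) t ∧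
      IsAdmissible (t, ψ (baseParameters t)) := by
    have m : ∀ᶠ t in 𝓝 (b, (0 : ℝ)), t.1 ∈ periodDomain :=
      continuousAt_fst.eventually (isOpen_periodDomain.mem_nhds hb)
    have l : ∀ᶠ t in 𝓝 (b, (0 : ℝ)), ∀ j, 0 < lowerArea (baseParameters t) (ψ (baseParameters t)) j
        := by
      rw [eventually_all]
      intro j
      have := ((continuous_lowerArea j).continuousAt.comp cPφ)
      refine this.eventually (lt_mem_nhds ?_)
      have h1 := H.lowerArea_pos (baseRatio b) j
      simp only [Function.comp_apply, ψ0]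
      exact h1
    have o : ∀ᶠ t in 𝓝 (b, (0 : ℝ)), ∀ q ∈ outerQuads,
        0 < vol (tent (baseParameters t) (ψ (baseParameters t)) q.1)
          (tent (baseParameters t) (ψ (baseParameters t)) q.2.1)
          (tent (baseParameters t) (ψ (baseParameters t)) q.2.2.1)
          (tent (baseParameters t) (ψ (baseParameters t)) q.2.2.2) := by
      have : ∀ᶠ t in 𝓝 (b, (0 : ℝ)), ∀ q ∈ outerQuads.toFinset,
        0 < vol (tent (baseParameters t) (ψ (baseParameters t)) q.1)
          (tent (baseParameters t) (ψ (baseParameters t)) q.2.1)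
          (tent (baseParameters t) (ψ (baseParameters t)) q.2.2.1)
          (tent (baseParameters t) (ψ (baseParameters t)) q.2.2.2) := by
        rw [Filter.eventually_all_finset]
        intro q hq
        have := ((continuous_vol_tent q.1 q.2.1 q.2.2.1 q.2.2.2).continuousAt.comp cPφ)
        refine this.eventually (lt_mem_nhds ?_)
        have h1 := H.vol_outer_pos (baseRatio b) q (List.mem_toFinset.1 hq)
        simp only [Function.comp_apply, ψ0]
        exact h1
      simpa only [List.mem_toFinset] using this
    have i : ∀ᶠ t in 𝓝 (b, (0 : ℝ)), ∀ q ∈ innerQuads,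
        0 < vol (tent (baseParameters (t.1, 1)) (ψ (baseParameters t)) q.1)
          (tent (baseParameters (t.1, 1)) (ψ (baseParameters t)) q.2.1)
          (tent (baseParameters (t.1, 1)) (ψ (baseParameters t)) q.2.2.1)
          (tent (baseParameters (t.1, 1)) (ψ (baseParameters t)) q.2.2.2) := by
      have : ∀ᶠ t in 𝓝 (b, (0 : ℝ)), ∀ q ∈ innerQuads.toFinset,
        0 < vol (tent (baseParameters (t.1, 1)) (ψ (baseParameters t)) q.1)
          (tent (baseParameters (t.1, 1)) (ψ (baseParameters t)) q.2.1)
          (tent (baseParameters (t.1, 1)) (ψ (baseParameters t)) q.2.2.1)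
          (tent (baseParameters (t.1, 1)) (ψ (baseParameters t)) q.2.2.2) := by
        rw [Filter.eventually_all_finset]
        intro q hq
        have := ((continuous_vol_tent q.1 q.2.1 q.2.2.1 q.2.2.2).continuousAt.comp cP1)
        refine this.eventually (lt_mem_nhds ?_)
        have h1 := H.vol_inner_pos (baseRatio_mul hb) q (List.mem_toFinset.1 hq)
        simp only [Function.comp_apply, ψ0]
        exact h1
      simpa only [List.mem_toFinset] using this
    filter_upwards [m, l, o, i, cP.eventually cψ.eventually_nhds, cP.eventually eψ] with t hm hl ho
        hi
      hc he
    exact ⟨ContinuousAt.comp hc.self_of_nhds (continuousAt_baseParameters hm), hm, he, hl, ho, hi⟩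
  obtain ⟨r, hr, hball⟩ := Metric.eventually_nhds_iff_ball.1 ev
  refine ⟨r, hr, ψ ∘ baseParameters, ψ0, hball, ?_⟩
  have cz : ContinuousAt (fun z : ((ℝ × ℝ) × ℝ) × (Fin 12 → ℝ) => (baseParameters z.1, z.2))
      ((b, 0), baseUnknowns b) :=
    (ContinuousAt.comp (f := Prod.fst) (g := baseParameters) cP continuousAt_fst).prodMk
        continuousAt_snd
  filter_upwards [cz.eventually (cdf.eventually_apply_eq_iff_implicitFunction one_ne_zero inv)]
    with z hz hz0
  exact hz.1 (hz0.trans h0.symm)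

open Filter Topology

/-! ### The family of pup tents -/

/-- The configuration of a point of the family. -/
def familyTent (z : ((ℝ × ℝ) × ℝ) × (Fin 12 → ℝ)) : Config := tent (baseParameters z.1) z.2

/-- The point of the upper half plane with given real and imaginary part. -/
def periodRatio {b : ℝ × ℝ} (hb : b ∈ periodDomain) : UpperHalfPlane := ⟨⟨b.1, b.2⟩, hb.2.2.1⟩

lemma continuousOn_familyTent :
    ContinuousOn familyTent {z | z.1.1 ∈ periodDomain} := by
  intro z hz
  have h : ContinuousAt (fun z : ((ℝ × ℝ) × ℝ) × (Fin 12 → ℝ) => (baseParameters z.1, z.2)) z :=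
    (ContinuousAt.comp (f := Prod.fst) (g := baseParameters) (continuousAt_baseParameters hz)
      continuousAt_fst).prodMk continuousAt_snd
  refine ContinuousAt.continuousWithinAt (continuousAt_pi.2 fun j => ?_)
  exact ContinuousAt.comp (g := fun u : (Fin 8 → ℝ) × (Fin 12 → ℝ) => tent u.1 u.2 j)
    (continuous_tent j).continuousAt h

namespace IsAdmissible

variable {z : ((ℝ × ℝ) × ℝ) × (Fin 12 → ℝ)}

lemma hasModelSigns (h : IsAdmissible z) (hz : 0 < z.1.2) : HasModelSigns (familyTent z) := by
  refine HasModelSigns.of_quads (tent_symm _ _) fun q hq => ?_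
  rcases List.mem_append.1 hq with hq | hq
  · exact (mul_pos hz (h.inner q hq)).trans_eq (vol_tent_eq_mul _ _ _ _ _ _ _ _ q hq).symm
  · exact h.outer q hq

lemma isDevelopment (h : IsAdmissible z) : IsDevelopment (familyTent z)
    (develop (baseParameters z.1) z.2) 2 (2 * (periodRatio h.mem : ℂ)) := by
  refine isDevelopment_develop ?_ h.edge h.lower
  have := (collapsedTent_base h.mem).eq_a
  change 2 * baseA₁ z.1.1 = (-baseHeight z.1.1 - 0) ^ 2 - 1
  rw [this]
  ring

lemma isPupTent (h : IsAdmissible z) (hz : 0 < z.1.2) : IsPupTent (familyTent z) :=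
  isPupTent_of_hasModelSigns (tent_symm _ _) (h.hasModelSigns hz) h.isDevelopment

lemma hasModulus (h : IsAdmissible z) (hz : 0 < z.1.2) :
    HasModulus ⟦⟨familyTent z, h.isPupTent hz⟩⟧ (toModularSurface (periodRatio h.mem)) :=
  ⟨⟨familyTent z, h.isPupTent hz⟩, rfl, _, _, _, _, h.isDevelopment, two_ne_zero, mul_comm _ _, rfl⟩

end IsAdmissible

/-! ### Connectedness -/

lemma isPreconnected_periodDomain : IsPreconnected periodDomain := by
  -- The domain lies above a graph over an interval: `t` measures `x ^ 2 + y ^ 2 - 2 * x`.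
  have h : periodDomain = (fun p : ℝ × ℝ => (p.1, √(2 * p.1 - p.1 ^ 2 + p.2))) ''
      (Set.Ioo 0 (1 / 2) ×ˢ Set.Ioi 0) := by
    ext ⟨x, y⟩
    simp only [periodDomain, Set.mem_ofPred_eq, Set.mem_image, Set.mem_prod, Set.mem_Ioo,
      Set.mem_Ioi, Prod.exists, Prod.mk.injEq]
    constructor
    · rintro ⟨h1, h2, h3, h4⟩
      refine ⟨x, x ^ 2 + y ^ 2 - 2 * x, ⟨⟨h1, h2⟩, by linarith⟩, rfl, ?_⟩
      rw [show 2 * x - x ^ 2 + (x ^ 2 + y ^ 2 - 2 * x) = y ^ 2 by ring, Real.sqrt_sq h3.le]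
    · rintro ⟨x', t, ⟨⟨h1, h2⟩, h3⟩, rfl, rfl⟩
      have h4 : 0 < 2 * x' - x' ^ 2 + t := by nlinarith
      refine ⟨h1, h2, Real.sqrt_pos.2 h4, ?_⟩
      rw [Real.sq_sqrt h4.le]
      linarith
  rw [h]
  refine IsPreconnected.image (isPreconnected_Ioo.prod isPreconnected_Ioi) _ ?_
  exact Continuous.continuousOn (by fun_prop)

/-- `V b` is the graph of the local section over a half ball with `s > 0`. For `b'` near `b`, the
section of `b'` tends as `s → 0` to the collapsed tent of `b'`, which is close to that of `b` by
continuity of `baseUnknowns`. Local uniqueness then makes the graphs meet, and connectedness of the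
domain chains the pieces. -/
lemma exists_isPathConnected_family : ∃ W : Set (((ℝ × ℝ) × ℝ) × (Fin 12 → ℝ)),
    IsPathConnected W ∧ (∀ z ∈ W, IsAdmissible z ∧ 0 < z.1.2) ∧
      ∀ b ∈ periodDomain, ∃ z ∈ W, z.1.1 = b := by
  choose! r hr φ φ0 hφ hu using fun b (hb : b ∈ periodDomain) => exists_section hb
  set V : ℝ × ℝ → Set (((ℝ × ℝ) × ℝ) × (Fin 12 → ℝ)) := fun b =>
    (fun t => (t, φ b t)) '' (Metric.ball (b, (0 : ℝ)) (r b) ∩ {t | 0 < t.2}) with hV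
  set W := ⋃ b ∈ periodDomain, V b with hW
  have hVW : ∀ b ∈ periodDomain, V b ⊆ W := fun b hb => Set.subset_biUnion_of_mem hb
  have hmem : ∀ b ∈ periodDomain, ∀ s, 0 < s → s < r b →
      ((b, s), φ b (b, s)) ∈ V b := fun b hb s hs hsr =>
    ⟨(b, s), ⟨by simpa [Prod.dist_eq, abs_of_pos hs, hr b hb] using hsr, hs⟩, rfl⟩
  have hVne : ∀ b ∈ periodDomain, ((b, r b / 2), φ b (b, r b / 2)) ∈ V b := fun b hb =>
    hmem b hb _ (half_pos (hr b hb)) (half_lt_self (hr b hb))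
  have hVpc : ∀ b ∈ periodDomain, IsPathConnected (V b) := fun b hb => by
    refine IsPathConnected.image' ?_ ?_
    · refine Convex.isPathConnected ((convex_ball _ _).inter ?_) ?_
      · exact (convex_Ioi (0 : ℝ)).is_linear_preimage (f := fun t : (ℝ × ℝ) × ℝ => t.2)
          ⟨fun _ _ => rfl, fun _ _ => rfl⟩
      · obtain ⟨t, ht, -⟩ := hVne b hb
        exact ⟨t, ht⟩
    · exact fun t ht => (continuousAt_id.prodMk (hφ b hb t ht.1).1).continuousWithinAt
  have hVmem : ∀ b ∈ periodDomain, ∀ z ∈ V b, IsAdmissible z ∧ 0 < z.1.2 := by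
    rintro b hb _ ⟨t, ⟨ht, ht0⟩, rfl⟩
    exact ⟨(hφ b hb t ht).2, ht0⟩
  have hjoin : ∀ b ∈ periodDomain, ∀ b' ∈ periodDomain, ∀ z ∈ V b, ∀ z' ∈ V b', JoinedIn W z z' :=
      by
    have near : ∀ b ∈ periodDomain, ∀ᶠ b' in 𝓝[periodDomain] b, ∀ z ∈ V b, ∀ z' ∈ V b',
        JoinedIn W z z' := by
      intro b hb
      have cb : ContinuousAt (fun b' : ℝ × ℝ => ((b', (0 : ℝ)), baseUnknowns b')) b :=
        (continuousAt_id.prodMk continuousAt_const).prodMk (continuousAt_base hb).2.2.2.2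
      have ev1 := cb.eventually (hu b hb).eventually_nhds
      have ev2 : ∀ᶠ b' in 𝓝 b, (b', (0 : ℝ)) ∈ Metric.ball (b, (0 : ℝ)) (r b) :=
        (continuousAt_id.prodMk continuousAt_const).eventually
          (Metric.isOpen_ball.mem_nhds (Metric.mem_ball_self (hr b hb)))
      filter_upwards [mem_nhdsWithin_of_mem_nhds (ev1.and ev2), self_mem_nhdsWithin]
        with b' ⟨h1, h2⟩ hb' z hz z' hz'
      have cφ : ContinuousAt (fun s : ℝ => ((b', s), φ b' (b', s))) 0 := by
        have h3 := (hφ b' hb' (b', 0) (Metric.mem_ball_self (hr b' hb'))).1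
        have h4 : ContinuousAt (fun s : ℝ => (b', s)) 0 := by fun_prop
        exact h4.prodMk (ContinuousAt.comp (f := fun s : ℝ => (b', s)) h3 h4)
      rw [← φ0 b' hb'] at h1
      have ev3 := cφ.eventually h1
      have ev4 : ∀ᶠ s in 𝓝 (0 : ℝ), (b', s) ∈ Metric.ball (b, (0 : ℝ)) (r b) := by
        have h4 : ContinuousAt (fun s : ℝ => (b', s)) 0 := by fun_prop
        exact h4.eventually (Metric.isOpen_ball.mem_nhds h2)
      have ev5 : ∀ᶠ s in 𝓝 (0 : ℝ), s < r b' := gt_mem_nhds (hr b' hb')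
      obtain ⟨s, ⟨h3, h4, h5⟩, hs⟩ :=
        (((ev3.and (ev4.and ev5)).filter_mono nhdsWithin_le_nhds).and
          (self_mem_nhdsWithin : Set.Ioi (0 : ℝ) ∈ 𝓝[>] 0)).exists
      have m1 := hmem b' hb' s hs h5
      -- The point of `V b'` over `(b', s)` solves the equations near the collapsed tent of `b`, so
      -- it is also the value of the section of `b`.
      have m2 : ((b', s), φ b' (b', s)) ∈ V b := by
        refine ⟨(b', s), ⟨h4, hs⟩, ?_⟩
        simp only [Prod.mk.injEq, true_and]
        exact h3 (hVmem b' hb' _ m1).1.edge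
      exact (((hVpc b hb).joinedIn z hz _ m2).mono (hVW b hb)).trans
        (((hVpc b' hb').joinedIn _ m1 z' hz').mono (hVW b' hb'))
    intro b hb b' hb'
    refine isPreconnected_periodDomain.induction₂
      (fun b b' => ∀ z ∈ V b, ∀ z' ∈ V b', JoinedIn W z z') near ?_ ?_ hb hb'
    · intro b₁ b₂ b₃ _ h₂ _ h12 h23 z hz z' hz'
      exact (h12 z hz _ (hVne b₂ h₂)).trans (h23 _ (hVne b₂ h₂) z' hz')
    · intro b₁ b₂ _ _ h12 z hz z' hz'
      exact (h12 z' hz' z hz).symm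
  refine ⟨W, isPathConnected_iff.2 ⟨?_, ?_⟩, ?_, ?_⟩
  · have hb : ((1 / 4, 1) : ℝ × ℝ) ∈ periodDomain := by
      refine ⟨?_, ?_, ?_, ?_⟩ <;> norm_num
    exact ⟨_, hVW _ hb (hVne _ hb)⟩
  · intro z hz z' hz'
    obtain ⟨b, hb, hz⟩ := Set.mem_iUnion₂.1 hz
    obtain ⟨b', hb', hz'⟩ := Set.mem_iUnion₂.1 hz'
    exact hjoin b hb b' hb' z hz z' hz'
  · intro z hz
    obtain ⟨b, hb, hz⟩ := Set.mem_iUnion₂.1 hz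
    exact hVmem b hb z hz
  · exact fun b hb => ⟨_, hVW b hb (hVne b hb), rfl⟩

/-! ### The interior of the bi-cusped domain -/

lemma mem_interior_biCuspedDomain_iff {τ : UpperHalfPlane} :
    τ ∈ interior biCuspedDomain ↔ (τ.re, τ.im) ∈ periodDomain := by
  have key : ∀ z : UpperHalfPlane, ‖(z : ℂ) - 1‖ ^ 2 = (z.re - 1) ^ 2 + z.im ^ 2 := fun z => by
    rw [← Complex.normSq_eq_norm_sq, Complex.normSq_apply]
    simp
    ring
  constructor
  · intro h
    have ev : ∀ᶠ t : ℝ in 𝓝 0, t +ᵥ τ ∈ biCuspedDomain := by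
      have c : ContinuousAt (fun t : ℝ => t +ᵥ τ) 0 := by
        rw [UpperHalfPlane.isEmbedding_coe.continuousAt_iff]
        have : ContinuousAt (fun t : ℝ => (t : ℂ) + (τ : ℂ)) 0 := by fun_prop
        exact this
      refine c.eventually ?_
      rw [show (fun t : ℝ => t +ᵥ τ) 0 = τ from zero_vadd ℝ τ]
      exact mem_interior_iff_mem_nhds.1 h
    have key' : ∀ t : ℝ, t +ᵥ τ ∈ biCuspedDomain → 0 ≤ t + τ.re ∧ t + τ.re ≤ 1 / 2 ∧
        1 ≤ (t + τ.re - 1) ^ 2 + τ.im ^ 2 := by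
      rintro t ⟨h1, h2, h3⟩
      have h4 : 1 ≤ ‖((t +ᵥ τ : UpperHalfPlane) : ℂ) - 1‖ ^ 2 := one_le_pow₀ h3
      rw [key] at h4
      simp only [UpperHalfPlane.vadd_re, UpperHalfPlane.vadd_im] at h1 h2 h4
      exact ⟨h1, h2, h4⟩
    -- A small shift to the right makes two bounds strict, since it also decreases the distance to
    -- `1`; a shift to the left makes `0 < τ.re` strict.
    obtain ⟨t, ht, ht0⟩ := ((ev.filter_mono nhdsWithin_le_nhds).and
      (self_mem_nhdsWithin : Set.Ioi (0 : ℝ) ∈ 𝓝[>] 0)).exists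
    obtain ⟨s, hs, hs0⟩ := ((ev.filter_mono nhdsWithin_le_nhds).and
      (self_mem_nhdsWithin : Set.Iio (0 : ℝ) ∈ 𝓝[<] 0)).exists
    obtain ⟨-, h2, h3⟩ := key' t ht
    obtain ⟨h1, -, -⟩ := key' s hs
    have ht1 : 0 < t := ht0
    have hs1 : s < 0 := hs0
    refine ⟨by linarith, by linarith, τ.im_pos, ?_⟩
    nlinarith
  · rintro ⟨h1, h2, h3, h4⟩
    simp only at h1 h2 h3 h4
    refine mem_interior.2 ⟨{z | 0 < z.re ∧ z.re < 1 / 2 ∧ 1 < (z.re - 1) ^ 2 + z.im ^ 2}, ?_, ?_,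
      h1, h2, by linarith⟩
    · rintro z ⟨g1, g2, g3⟩
      refine ⟨g1.le, g2.le, ?_⟩
      rw [← key] at g3
      by_contra hc
      nlinarith [norm_nonneg ((z : ℂ) - 1)]
    · have cr := UpperHalfPlane.continuous_re
      have ci := UpperHalfPlane.continuous_im
      simp only [Set.ofPred_and]
      exact (isOpen_lt (by fun_prop) (by fun_prop)).inter
        ((isOpen_lt (by fun_prop) (by fun_prop)).inter (isOpen_lt (by fun_prop) (by fun_prop)))

lemma biCuspedInterior_eq {m : ModularSurface} : m ∈ biCuspedInterior ↔
    ∃ (b : ℝ × ℝ) (hb : b ∈ periodDomain), toModularSurface (periodRatio hb) = m := by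
  constructor
  · rintro ⟨τ, hτ, rfl⟩
    exact ⟨(τ.re, τ.im), mem_interior_biCuspedDomain_iff.1 hτ, rfl⟩
  · rintro ⟨b, hb, rfl⟩
    exact ⟨periodRatio hb, mem_interior_biCuspedDomain_iff.2 hb, rfl⟩

end PupTent

end

/-! ### Passage to similarity classes. -/

theorem mainTheorem1 :
    ∃ U : Set PupTent.Space,
      IsPathConnected U ∧
      (∀ T ∈ U, T.InGeneralPosition) ∧
      (∀ T ∈ U, ∀ m, PupTent.HasModulus T m ↔ m = PupTent.Phi T) ∧
      PupTent.Phi '' U = PupTent.biCuspedInterior := by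
  open PupTent in
  obtain ⟨W, hW, hWa, hWs⟩ := exists_isPathConnected_family
  -- Path-connectedness is proved for actual configurations and transported through the subtype
  -- topology, then through the continuous quotient map.
  set K : Set {P : Config | IsPupTent P} := (↑) ⁻¹' (familyTent '' W) with hK
  have hKpc : IsPathConnected K := by
    refine IsPathConnected.preimage_coe (hW.image' ?_) ?_
    · exact continuousOn_familyTent.mono fun z hz => (hWa z hz).1.mem
    · rintro _ ⟨z, hz, rfl⟩
      exact (hWa z hz).1.isPupTent (hWa z hz).2
  have hU : ∀ T ∈ (Quotient.mk similarSetoid) '' K, ∃ z, ∃ hz : z ∈ W,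
      T = ⟦⟨familyTent z, (hWa z hz).1.isPupTent (hWa z hz).2⟩⟧ := by
    rintro _ ⟨P, ⟨z, hz, hP⟩, rfl⟩
    exact ⟨z, hz, congrArg _ (Subtype.ext hP.symm)⟩
  refine ⟨(Quotient.mk similarSetoid) '' K, hKpc.image continuous_quotient_mk', ?_, ?_, ?_⟩
  · intro T hT
    obtain ⟨z, hz, rfl⟩ := hU T hT
    exact Space.inGeneralPosition_mk ((hWa z hz).1.hasModelSigns (hWa z hz).2).inGeneralPosition
  · intro T hT m
    obtain ⟨z, hz, rfl⟩ := hU T hT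
    exact ((hWa z hz).1.hasModulus (hWa z hz).2).iff m
  · ext m
    rw [biCuspedInterior_eq]
    constructor
    · rintro ⟨T, hT, rfl⟩
      obtain ⟨z, hz, rfl⟩ := hU T hT
      exact ⟨z.1.1, (hWa z hz).1.mem, ((hWa z hz).1.hasModulus (hWa z hz).2).phi_eq.symm⟩
    · rintro ⟨b, hb, rfl⟩
      obtain ⟨z, hz, rfl⟩ := hWs b hb
      refine ⟨⟦⟨familyTent z, (hWa z hz).1.isPupTent (hWa z hz).2⟩⟧,
        ⟨⟨familyTent z, (hWa z hz).1.isPupTent (hWa z hz).2⟩, ⟨z, hz, rfl⟩, rfl⟩, ?_⟩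
      exact ((hWa z hz).1.hasModulus (hWa z hz).2).phi_eq
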